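/- A quiver $Q=(Q_0,Q_1,h,t)$ is a finite directed graph, with head and tail maps $h,t:Q_1\to Q_0$. A representation of $Q$ consists of finite-dimensional complex vector spaces $(V_i)_{i\in Q_0}$ and linear maps $\varphi_\alpha:V_{t\alpha}\to V_{h\alpha}$ for $\alpha\in Q_1$; a subrepresentation is a family of subspaces preserved by all the $\varphi_\alpha$. For $\theta\in\mathbb{R}^{Q_0}$, the $\theta$-slope of a nonzero representation $V$ is $$\mu_\theta(V)=\frac{\sum_{i\in Q_0}\theta_i\dim V_i}{\sum_{i\in Q_0}\dim V_i}.$$ A nonzero representation $V$ is $\theta$-stable if $\mu_\theta(F)<\mu_\theta(V)$ for every subrepresentation $F$ with $0\ne F\ne V$; a representation is $\theta$-polystable if it is isomorphic to a finite (possibly empty) direct sum of $\theta$-stable representations, all of the same $\theta$-slope. For quivers $Q',Q''$, the tensor quiver $Q'\otimes Q''$ has vertex set $Q'_0\times Q''_0$ and edge set $(Q'_1\times Q''_0)\sqcup(Q'_0\times Q''_1)$, where $(\alpha,j)$ goes from $(t\alpha,j)$ to $(h\alpha,j)$ and $(i,\beta)$ goes from $(i,t\beta)$ to $(i,h\beta)$.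 For representations $\varphi=((V_i),(\varphi_\alpha))$ of $Q'$ and $\psi=((W_j),(\psi_\beta))$ of $Q''$, the representation $\varphi\otimes\psi$ of $Q'\otimes Q''$ has the space $V_i\otimes W_j$ at $(i,j)$, the map $\varphi_\alpha\otimes\mathrm{Id}$ along $(\alpha,j)$ and the map $\mathrm{Id}\otimes\psi_\beta$ along $(i,\beta)$. Corollary. Let $\theta'\in\mathbb{R}^{Q'_0}$ and $\theta''\in\mathbb{R}^{Q''_0}$. If $\varphi$ is a $\theta'$-polystable representation of $Q'$ and $\psi$ is a $\theta''$-polystable representation of $Q''$, then $\varphi\otimes\psi$ is a $\theta$-polystable representation of $Q'\otimes Q''$ for $\theta=(\theta'_i+\theta''_j)_{(i,j)\in Q'_0\times Q''_0}$. -/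

import Mathlib

open scoped TensorProduct

universe u u₁ u₂ v v₁ v₂ w w₁ w₂

/-- Vertices of the tensor quiver `Q' ⊗ Q''`: pairs of vertices. -/
@[ext]
structure TensorQuiver (V' : Type u₁) (V'' : Type u₂) : Type (max u₁ u₂) where
  fst : V'
  snd : V''

/-- Vertices of the tensor quiver as elements of the product. -/
def TensorQuiver.equivProd (V' : Type u₁) (V'' : Type u₂) : V' × V'' ≃ TensorQuiver V' V'' where
  toFun p := ⟨p.1, p.2⟩
  invFun p := (p.fst, p.snd)
  left_inv _ := rfl
  right_inv _ := rfl

instance TensorQuiver.instFintype (V' : Type u₁) (V'' : Type u₂) [Fintype V'] [Fintype V''] :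
    Fintype (TensorQuiver V' V'') :=
  Fintype.ofEquiv (V' × V'') (TensorQuiver.equivProd V' V'')

/-- The edges of the tensor quiver, sorted by tail and head: an edge `(α, j) : (tα, j) ⟶ (hα, j)` for
every edge `α` of `Q'` and vertex `j` of `Q''`, and an edge `(i, β) : (i, tβ) ⟶ (i, hβ)` for every
vertex `i` of `Q'` and edge `β` of `Q''`. -/
inductive TensorQuiver.Edge (V' : Type u₁) (V'' : Type u₂) [Quiver.{v₁} V'] [Quiver.{v₂} V''] :
    TensorQuiver V' V'' → TensorQuiver V' V'' → Type (max u₁ u₂ v₁ v₂)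
  | left {i k : V'} (α : i ⟶ k) (j : V'') : TensorQuiver.Edge V' V'' ⟨i, j⟩ ⟨k, j⟩
  | right (i : V') {j l : V''} (β : j ⟶ l) : TensorQuiver.Edge V' V'' ⟨i, j⟩ ⟨i, l⟩

instance TensorQuiver.instQuiver (V' : Type u₁) (V'' : Type u₂)
    [Quiver.{v₁} V'] [Quiver.{v₂} V''] : Quiver (TensorQuiver V' V'') where
  Hom := TensorQuiver.Edge V' V''

/-- A finite-dimensional complex representation of a quiver with vertex type `V`. -/
structure QuiverRep (V : Type u) [Quiver.{v} V] where
  /-- the vector space at a vertex -/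
  obj : V → Type w
  [addCommGroup : ∀ i, AddCommGroup (obj i)]
  [module : ∀ i, Module ℂ (obj i)]
  [finite : ∀ i, FiniteDimensional ℂ (obj i)]
  /-- the linear map along an edge -/
  map : ∀ {i j : V}, (i ⟶ j) → (obj i →ₗ[ℂ] obj j)

namespace QuiverRep

attribute [instance] QuiverRep.addCommGroup QuiverRep.module QuiverRep.finite

variable {V : Type u} [Quiver.{v} V]

/-- An isomorphism of representations. -/
structure Iso (E : QuiverRep.{u, v, w₁} V) (F : QuiverRep.{u, v, w₂} V) where
  /-- the linear isomorphism at a vertex -/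
  equiv : ∀ i, E.obj i ≃ₗ[ℂ] F.obj i
  comm : ∀ {i j : V} (α : i ⟶ j) (x : E.obj i), equiv j (E.map α x) = F.map α (equiv i x)

/-- A subrepresentation: subspaces at all vertices that the edge maps preserve. -/
structure Subrep (E : QuiverRep.{u, v, w} V) where
  /-- the subspace at a vertex -/
  carrier : ∀ i, Submodule ℂ (E.obj i)
  map_mem : ∀ {i j : V} (α : i ⟶ j), ∀ x ∈ carrier i, E.map α x ∈ carrier j

/-- A subrepresentation as a representation. -/
def Subrep.toRep {E : QuiverRep.{u, v, w} V} (F : Subrep E) : QuiverRep.{u, v, w} V where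
  obj i := F.carrier i
  map α := (E.map α).restrict (F.map_mem α)

/-- The direct sum of a finite family of representations (the finite direct sum of vector spaces at
a vertex is realised as the product). -/
def directSum {ι : Type} [Fintype ι] (S : ι → QuiverRep.{u, v, w} V) : QuiverRep.{u, v, w} V where
  obj i := ∀ k, (S k).obj i
  map α := LinearMap.piMap fun k => (S k).map α

/-- The `θ`-slope `(∑ i, θ i * dim E i) / (∑ i, dim E i)`, meaningful for nonzero `E`. -/
noncomputable def slope [Fintype V] (θ : V → ℝ) (E : QuiverRep.{u, v, w} V) : ℝ :=
  (∑ i, θ i * (Module.finrank ℂ (E.obj i) : ℝ)) / ∑ i, (Module.finrank ℂ (E.obj i) : ℝ)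

/-- `E` is `θ`-stable: it is nonzero, and every subrepresentation other than zero and `E` has
slope strictly smaller than that of `E`. -/
def IsStable [Fintype V] (θ : V → ℝ) (E : QuiverRep.{u, v, w} V) : Prop :=
  (∃ i, Nontrivial (E.obj i)) ∧
    ∀ F : Subrep E, (∃ i, F.carrier i ≠ ⊥) → (∃ i, F.carrier i ≠ ⊤) →
      slope θ F.toRep < slope θ E

/-- `E` is `θ`-polystable: it is isomorphic to a finite direct sum of `θ`-stable representations,
all of the same `θ`-slope. (The zero representation is the empty direct sum.) -/
def IsPolystable [Fintype V] (θ : V → ℝ) (E : QuiverRep.{u, v, w} V) : Prop :=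
  ∃ (n : ℕ) (S : Fin n → QuiverRep.{u, v, w} V),
    (∀ k, IsStable θ (S k)) ∧ (∀ k l, slope θ (S k) = slope θ (S l)) ∧
      Nonempty (Iso E (directSum S))

/-- The tensor product `φ ⊗ ψ`, a representation of the tensor quiver: the space at `(i, j)` is
`φ i ⊗ ψ j`, the map along `(α, j)` is `φ α ⊗ id` and the map along `(i, β)` is `id ⊗ ψ β`. -/
noncomputable def tensor {V' : Type u₁} {V'' : Type u₂} [Quiver.{v₁} V'] [Quiver.{v₂} V'']
    (φ : QuiverRep.{u₁, v₁, w₁} V') (ψ : QuiverRep.{u₂, v₂, w₂} V'') :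
    QuiverRep.{max u₁ u₂, max u₁ u₂ v₁ v₂, max w₁ w₂} (TensorQuiver V' V'') where
  obj p := φ.obj p.fst ⊗[ℂ] ψ.obj p.snd
  map
    | TensorQuiver.Edge.left α j => TensorProduct.map (φ.map α) (LinearMap.id : ψ.obj j →ₗ[ℂ] ψ.obj j)
    | TensorQuiver.Edge.right i β => TensorProduct.map (LinearMap.id : φ.obj i →ₗ[ℂ] φ.obj i) (ψ.map β)

end QuiverRep

/-! A representation is polystable of slope μ exactly when it carries hermitian metrics solving
King's moment map equation with weights θ - μ (the Kempf–Ness principle). This equation is additive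
under tensor products: every edge of the tensor quiver moves only one factor, so its left-hand side
at (k, l) is the sum of the left-hand sides at k and l, each tensored with an identity
(`HermRep.IsKing.tensor`). It therefore suffices to pass from polystability to metrics and back.

From stability to a metric (`HermRep.exists_isKing_of_isStable`): minimise the squared norm of the
matrices minus a weighted log-determinant over all frames. Every frame is unitary times positive
diagonal times unitary, and the last factor does not matter. The problem thus lives on a compact
group times a real vector space, where the function is a sum of exponentials plus a linear form.
Stability, applied to the sublevel subrepresentations of an adapted basis (`IsStable.sum_pos`),
makes it coercive uniformly over the compact factor, so a minimum exists
(`exists_isMin_torusEnergy`). Criticality there is King's equation. Orthogonal direct sums handle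
polystable representations.

From a metric to polystability (`IsKing.isPolystableOfSlope`): the degree of a subrepresentation is
minus the squared norm of the part of the edge maps leading from its orthogonal complement into it
(`IsKing.degree_sub`). A subrepresentation violating stability has degree zero, so its complement is
a subrepresentation too, and induction on dimension splits everything into stable pieces. -/

/-! ### Minimising the energy on a family of tori -/

section KempfNess

open Real

variable {X N M : Type*} [Fintype N] [Fintype M]

/-- The restriction to a maximal torus, in logarithmic coordinates, of a Kempf–Ness function. -/
noncomputable def torusEnergy (W : M → X → ℝ) (b a : M → N) (c : N → ℝ) (k : X) (x : N → ℝ) : ℝ :=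
  ∑ m, W m k * exp (x (b m) - x (a m)) + ∑ p, c p * x p

theorem continuous_torusEnergy [TopologicalSpace X] {W : M → X → ℝ} (b a : M → N) (c : N → ℝ)
    (hW : ∀ m, Continuous (W m)) :
    Continuous fun q : X × (N → ℝ) => torusEnergy W b a c q.1 q.2 := by
  unfold torusEnergy
  fun_prop

theorem torusEnergy_add_const (W : M → X → ℝ) (b a : M → N) {c : N → ℝ} (hc : ∑ p, c p = 0)
    (k : X) (x : N → ℝ) (r : ℝ) :
    torusEnergy W b a c k (fun p => x p + r) = torusEnergy W b a c k x := by
  simp [torusEnergy, mul_add, Finset.sum_add_distrib, ← Finset.sum_mul, hc]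

theorem sq_posPart_div_two_le_exp (y : ℝ) : (max y 0) ^ 2 / 2 ≤ exp y := by
  rcases le_total y 0 with h | h
  · simp [h, (exp_pos y).le]
  · have := quadratic_le_exp_of_nonneg h
    rw [max_eq_left h]
    linarith

/-- Modulo constants the energy tends to infinity in `x`, uniformly in `k`. Along a unit direction
either the linear form is bounded below by a positive constant, or some exponential with nonzero
weight grows; compactness makes this alternative quantitative. Letting `k` vary is essential, since
the set of nonzero weights may jump. -/
theorem exists_isMin_torusEnergy [TopologicalSpace X] {W : M → X → ℝ} {b a : M → N} {c : N → ℝ} {K : Set X}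
    (hK : IsCompact K) (hne : K.Nonempty) (hW : ∀ m, Continuous (W m)) (hW0 : ∀ m k, 0 ≤ W m k)
    (hc : ∑ p, c p = 0)
    (hpos : ∀ k ∈ K, ∀ x : N → ℝ, (∃ p q, x p < x q) →
      (∀ m, W m k ≠ 0 → x (b m) ≤ x (a m)) → 0 < ∑ p, c p * x p) :
    ∃ k₀ ∈ K, ∃ x₀ : N → ℝ, ∀ k ∈ K, ∀ x : N → ℝ,
      torusEnergy W b a c k₀ x₀ ≤ torusEnergy W b a c k x := by
  -- A continuous, degree-two homogeneous stand-in for the exponentials: it vanishes exactly when no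
  -- exponential with nonzero weight grows along `x`.
  set P : X → (N → ℝ) → ℝ := fun k x => ∑ m, W m k * (max (x (b m) - x (a m)) 0) ^ 2 with hP
  set ℓ : (N → ℝ) → ℝ := fun x => ∑ p, c p * x p with hℓ
  set S : Set (N → ℝ) := Metric.sphere 0 1 ∩ {x | ∑ p, x p = 0} with hS
  have hclosed : IsClosed {x : N → ℝ | ∑ p, x p = 0} :=
    isClosed_eq (by fun_prop) continuous_const
  have hScomp : IsCompact S := (isCompact_sphere _ _).inter_right hclosed
  have hP0 : ∀ k x, 0 ≤ P k x := fun k x =>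
    Finset.sum_nonneg fun m _ => mul_nonneg (hW0 m k) (sq_nonneg _)
  obtain ⟨δ, hδ, hδle⟩ : ∃ δ : ℝ, 0 < δ ∧ ∀ q ∈ K ×ˢ S, δ ≤ P q.1 q.2 + max (ℓ q.2) 0 := by
    refine (hK.prod hScomp).exists_forall_le' (f := fun q => P q.1 q.2 + max (ℓ q.2) 0)
      (by simp only [hP, hℓ]; fun_prop) ?_
    rintro ⟨k, x⟩ ⟨hk, hx, hx0⟩
    by_contra hcon
    have h1 : P k x = 0 ∧ ℓ x ≤ 0 := by
      have := hP0 k x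
      have h2 := le_max_right (ℓ x) 0
      have h3 := le_max_left (ℓ x) 0
      simp only at hcon
      constructor <;> linarith
    have hconst : ∃ p q, x p < x q := by
      by_contra! hall
      have heq : ∀ p q, x p = x q := fun p q => le_antisymm (hall q p) (hall p q)
      have : x = 0 := by
        ext p
        have hx0' : ∑ q, x q = 0 := hx0
        rw [Finset.sum_congr rfl fun q _ => heq q p, Finset.sum_const, Finset.card_univ,
          nsmul_eq_mul] at hx0'
        rcases mul_eq_zero.1 hx0' with h | h
        · have : Nonempty N := ⟨p⟩
          simp at h
        · exact h
      simp [this] at hx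
    refine absurd (hpos k hk x hconst fun m hm => ?_) (not_lt.2 h1.2)
    have := (Finset.sum_eq_zero_iff_of_nonneg
      fun m _ => mul_nonneg (hW0 m k) (sq_nonneg _)).1 h1.1 m (Finset.mem_univ _)
    rcases mul_eq_zero.1 this with h | h
    · exact absurd h hm
    · have := le_max_left (x (b m) - x (a m)) 0
      rw [pow_eq_zero_iff two_ne_zero] at h
      linarith
  obtain ⟨C, hC⟩ : ∃ C : ℝ, ∀ x ∈ S, |ℓ x| ≤ C :=
    hScomp.exists_bound_of_continuousOn (f := ℓ) (by simp only [hℓ]; fun_prop)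
  obtain ⟨k₁, hk₁⟩ := hne
  set e₁ := torusEnergy W b a c k₁ 0 with he₁
  have hbig : ∀ k ∈ K, ∀ y ∈ S, ∀ r : ℝ, 0 ≤ r →
      min (r * (δ / 2)) (r * (r * (δ / 4) - C)) ≤ torusEnergy W b a c k (r • y) := by
    intro k hk y hy r hr
    have hexp : r ^ 2 / 2 * P k y ≤ ∑ m, W m k * exp ((r • y) (b m) - (r • y) (a m)) := by
      rw [hP, Finset.mul_sum]
      refine Finset.sum_le_sum fun m _ => ?_
      have h1 := sq_posPart_div_two_le_exp ((r • y) (b m) - (r • y) (a m))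
      have h2 : max ((r • y) (b m) - (r • y) (a m)) 0 = r * max (y (b m) - y (a m)) 0 := by
        rw [mul_max_of_nonneg _ _ hr]
        simp [mul_sub]
      rw [h2] at h1
      calc _ = W m k * ((r * max (y (b m) - y (a m)) 0) ^ 2 / 2) := by ring
        _ ≤ _ := mul_le_mul_of_nonneg_left h1 (hW0 m k)
    have hlin : ∑ p, c p * (r • y) p = r * ℓ y := by
      simp only [hℓ, Finset.mul_sum, Pi.smul_apply, smul_eq_mul]
      exact Finset.sum_congr rfl fun p _ => by ring
    have hE : r ^ 2 / 2 * P k y + r * ℓ y ≤ torusEnergy W b a c k (r • y) := by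
      rw [torusEnergy, hlin]
      linarith
    refine le_trans ?_ hE
    rcases le_total (δ / 2) (ℓ y) with h | h
    · refine (min_le_left _ _).trans ?_
      have := mul_nonneg (by positivity : 0 ≤ r ^ 2 / 2) (hP0 k y)
      have := mul_le_mul_of_nonneg_left h hr
      linarith
    · refine (min_le_right _ _).trans ?_
      have h1 := hδle (k, y) ⟨hk, hy⟩
      have h2 : max (ℓ y) 0 ≤ δ / 2 := max_le h (by linarith)
      have h3 : δ / 2 ≤ P k y := by simp only at h1; linarith
      have h4 := mul_le_mul_of_nonneg_left h3 (by positivity : 0 ≤ r ^ 2 / 2)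
      have h5 := mul_le_mul_of_nonneg_left (abs_le.1 (hC y hy)).1 hr
      nlinarith
  obtain ⟨R, hR0, hR⟩ : ∃ R : ℝ, 0 ≤ R ∧ ∀ r, R < r →
      e₁ < min (r * (δ / 2)) (r * (r * (δ / 4) - C)) := by
    -- The first inner bound handles the linear alternative, the second makes `r * (δ / 4) - C` at
    -- least `|e₁| + 1`, and the final `+ 1` ensures `r > 1`, so multiplying by `r` loses nothing.
    refine ⟨max 0 (max (2 / δ * |e₁|) (4 / δ * (|C| + |e₁| + 1)) + 1), le_max_left _ _,
      fun r hr => ?_⟩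
    have hr1 : 1 < r + 0 := by
      have h1 : 0 ≤ max (2 / δ * |e₁|) (4 / δ * (|C| + |e₁| + 1)) :=
        le_max_of_le_left (by positivity)
      have := le_max_right 0 (max (2 / δ * |e₁|) (4 / δ * (|C| + |e₁| + 1)) + 1)
      linarith
    have hr2 : 2 / δ * |e₁| < r := by
      have h1 := le_max_left (2 / δ * |e₁|) (4 / δ * (|C| + |e₁| + 1))
      have := le_max_right 0 (max (2 / δ * |e₁|) (4 / δ * (|C| + |e₁| + 1)) + 1)
      linarith
    have hr3 : 4 / δ * (|C| + |e₁| + 1) < r := by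
      have h1 := le_max_right (2 / δ * |e₁|) (4 / δ * (|C| + |e₁| + 1))
      have := le_max_right 0 (max (2 / δ * |e₁|) (4 / δ * (|C| + |e₁| + 1)) + 1)
      linarith
    rw [div_mul_eq_mul_div, div_lt_iff₀ hδ] at hr2 hr3
    have := le_abs_self e₁
    have := le_abs_self C
    refine lt_min (by linarith) ?_
    have h6 : |e₁| + 1 ≤ r * (δ / 4) - C := by linarith
    have h7 : 1 * (r * (δ / 4) - C) ≤ r * (r * (δ / 4) - C) :=
      mul_le_mul_of_nonneg_right (by linarith) (by linarith [abs_nonneg e₁])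
    linarith
  have hTcomp : IsCompact (K ×ˢ (Metric.closedBall (0 : N → ℝ) R ∩ {x | ∑ p, x p = 0})) :=
    hK.prod ((isCompact_closedBall _ _).inter_right hclosed)
  obtain ⟨⟨k₀, x₀⟩, ⟨hk₀, -⟩, hmin⟩ := hTcomp.exists_isMinOn
    ⟨(k₁, 0), hk₁, by simp [hR0], by simp⟩ (continuous_torusEnergy b a c hW).continuousOn
  refine ⟨k₀, hk₀, x₀, fun k hk x => ?_⟩
  have key : ∀ z : N → ℝ, ∑ p, z p = 0 →
      torusEnergy W b a c k₀ x₀ ≤ torusEnergy W b a c k z := by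
    intro z hz
    rcases le_or_gt ‖z‖ R with h | h
    · exact hmin (a := (k, z)) ⟨hk, by simpa using h, hz⟩
    · have hz0 : 0 < ‖z‖ := hR0.trans_lt h
      have hy : ‖z‖⁻¹ • z ∈ S := by
        refine ⟨by simp [norm_smul, hz0.ne'], ?_⟩
        simp [← Finset.mul_sum, hz]
      have h1 := hbig k hk _ hy ‖z‖ hz0.le
      rw [smul_inv_smul₀ hz0.ne'] at h1
      have h2 : torusEnergy W b a c k₀ x₀ ≤ e₁ :=
        hmin (a := (k₁, 0)) ⟨hk₁, by simp [hR0], by simp⟩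
      exact h2.trans ((hR _ h).le.trans h1)
  rw [← torusEnergy_add_const W b a hc k x (-((∑ p, x p) / Fintype.card N))]
  refine key _ ?_
  rcases isEmpty_or_nonempty N with h | h
  · simp
  · simp only [Finset.sum_add_distrib, Finset.sum_const, Finset.card_univ, nsmul_eq_mul]
    field_simp
    ring

/-- Vanishing of the derivative of the energy at a minimum. -/
theorem torusEnergy_critical {W : M → X → ℝ} {b a : M → N} {c : N → ℝ} {k : X}
    (hmin : ∀ x, torusEnergy W b a c k 0 ≤ torusEnergy W b a c k x) (y : N → ℝ) :
    ∑ m, W m k * (y (b m) - y (a m)) + ∑ p, c p * y p = 0 := by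
  have hder : HasDerivAt (fun r : ℝ => torusEnergy W b a c k (r • y))
      (∑ m, W m k * (y (b m) - y (a m)) + ∑ p, c p * y p) 0 := by
    unfold torusEnergy
    refine HasDerivAt.add (HasDerivAt.fun_sum fun m _ => ?_) (HasDerivAt.fun_sum fun p _ => ?_)
    · have h := ((((hasDerivAt_id (0 : ℝ)).mul_const (y (b m))).sub
        ((hasDerivAt_id (0 : ℝ)).mul_const (y (a m)))).exp).const_mul (W m k)
      simpa using h
    · have h := ((hasDerivAt_id (0 : ℝ)).mul_const (y p)).const_mul (c p)
      simpa using h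
  refine IsLocalMin.hasDerivAt_eq_zero (Filter.Eventually.of_forall fun r => ?_) hder
  simpa using hmin (r • y)

/-- Abel summation: if the weights `c` have negative sum over each proper nonempty sublevel set of
the nonconstant function `x`, then they pair positively with `x`. -/
theorem sum_mul_pos_of_sublevel_neg {c : N → ℝ} (hc : ∑ p, c p = 0) {x : N → ℝ}
    (hx : ∃ p q, x p < x q)
    (hneg : ∀ r, (∃ p, x p ≤ r) → (∃ q, r < x q) → ∑ p with x p ≤ r, c p < 0) :
    0 < ∑ p, c p * x p := by
  classical
  obtain ⟨n, hn⟩ : ∃ n, (Finset.univ.image x).card = n := ⟨_, rfl⟩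
  induction n using Nat.strong_induction_on generalizing x with
  | _ n ih =>
    obtain ⟨p₀, q₀, h₀⟩ := hx
    have : Nonempty N := ⟨p₀⟩
    obtain ⟨p, hp⟩ := Finite.exists_min x
    have hlt : x p < x q₀ := (hp p₀).trans_lt h₀
    obtain ⟨q, hq, hqmin⟩ := Finset.exists_min_image (Finset.univ.filter fun q => x p < x q) x
      ⟨q₀, by simpa using hlt⟩
    simp only [Finset.mem_filter, Finset.mem_univ, true_and] at hq hqmin
    -- Raise the lowest level to the second lowest. This removes one value, and the change in the
    -- pairing is the gap times minus the weight of the lowest level set, which is positive.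
    set x' : N → ℝ := fun r => max (x r) (x q) with hx'
    have hsum : ∑ r, c r * x r
        = ∑ r, c r * x' r + (x q - x p) * -∑ r with x r ≤ x p, c r := by
      rw [Finset.sum_filter, mul_neg, Finset.mul_sum, ← sub_eq_add_neg, ← Finset.sum_sub_distrib]
      refine Finset.sum_congr rfl fun r _ => ?_
      by_cases h : x r ≤ x p
      · have h1 : x r = x p := le_antisymm h (hp r)
        have h2 : x' r = x q := max_eq_right (by rw [h1]; exact hq.le)
        rw [if_pos h, h2, h1]
        ring
      · have h2 : x' r = x r := max_eq_left (hqmin r (not_le.1 h))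
        rw [if_neg h, h2]
        ring
    have hD := hneg (x p) ⟨p, le_rfl⟩ ⟨q, hq⟩
    have hprod : 0 < (x q - x p) * -∑ r with x r ≤ x p, c r :=
      mul_pos (by linarith) (by linarith)
    rw [hsum]
    by_cases hx'c : ∃ p q, x' p < x' q
    · refine add_pos (ih _ ?_ hx'c ?_ rfl) hprod
      · rw [← hn]
        refine Finset.card_lt_card ⟨?_, fun hsub => ?_⟩
        · intro z hz
          obtain ⟨r, -, rfl⟩ := Finset.mem_image.1 hz
          rcases max_choice (x r) (x q) with h | h
          · exact Finset.mem_image.2 ⟨r, Finset.mem_univ _, h.symm⟩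
          · exact Finset.mem_image.2 ⟨q, Finset.mem_univ _, h.symm⟩
        · obtain ⟨r, -, hr⟩ := Finset.mem_image.1
            (hsub (Finset.mem_image.2 ⟨p, Finset.mem_univ _, rfl⟩))
          have := le_max_right (x r) (x q)
          simp only [hx'] at hr
          linarith
      · rintro r ⟨p₁, hp₁⟩ ⟨q₁, hq₁⟩
        have hqr : x q ≤ r := (le_max_right _ _).trans hp₁
        have hfil : (Finset.univ.filter fun s => x' s ≤ r) = Finset.univ.filter fun s => x s ≤ r := by
          ext s
          simp [hx', hqr]
        rw [hfil]
        refine hneg r ⟨p₁, (le_max_left _ _).trans hp₁⟩ ⟨q₁, ?_⟩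
        rcases lt_max_iff.1 hq₁ with h | h
        · exact h
        · exact absurd h (not_lt.2 hqr)
    · push Not at hx'c
      have hconst : ∑ r, c r * x' r = 0 := by
        rw [Finset.sum_congr rfl fun r _ => by rw [le_antisymm (hx'c p r) (hx'c r p)],
          ← Finset.sum_mul, hc, zero_mul]
      rw [hconst, zero_add]
      exact hprod

end KempfNess

/-! ### Frames, unitary reduction and critical points -/

section Frames

open Real Matrix
open scoped ComplexOrder

theorem isCompact_unitaryGroup (n : Type*) [Fintype n] [DecidableEq n] :
    IsCompact {U : Matrix n n ℂ | U ∈ unitaryGroup n ℂ} := by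
  refine IsCompact.of_isClosed_subset
    (isCompact_univ_pi fun _ : n => isCompact_univ_pi fun _ : n =>
      isCompact_closedBall (0 : ℂ) 1) ?_ ?_
  · simp only [mem_unitaryGroup_iff]
    exact isClosed_eq (by fun_prop) continuous_const
  · intro U hU i _ j _
    simpa using entry_norm_bound_of_unitary hU i j

/-- The squared Frobenius norm of a matrix. -/
noncomputable def frobSq {m n : Type*} [Fintype m] [Fintype n] (B : Matrix m n ℂ) : ℝ :=
  ∑ b, ∑ a, ‖B b a‖ ^ 2

theorem ofReal_frobSq {m n : Type*} [Fintype m] [Fintype n] (B : Matrix m n ℂ) :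
    (frobSq B : ℂ) = (B * Bᴴ).trace := by
  simp [frobSq, trace, mul_apply, Complex.mul_conj, Complex.normSq_eq_norm_sq]

theorem frobSq_mul_unitary {m n : Type*} [Fintype m] [Fintype n] [DecidableEq m] [DecidableEq n]
    {U : Matrix m m ℂ} {U' : Matrix n n ℂ} (hU : U ∈ unitaryGroup m ℂ)
    (hU' : U' ∈ unitaryGroup n ℂ) (B : Matrix m n ℂ) : frobSq (Uᴴ * B * U') = frobSq B := by
  have h1 : U * Uᴴ = 1 := mem_unitaryGroup_iff.1 hU
  have h2 : U' * U'ᴴ = 1 := mem_unitaryGroup_iff.1 hU'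
  have : (frobSq (Uᴴ * B * U') : ℂ) = frobSq B := by
    rw [ofReal_frobSq, ofReal_frobSq]
    simp only [conjTranspose_mul, conjTranspose_conjTranspose]
    calc (Uᴴ * B * U' * (U'ᴴ * (Bᴴ * U))).trace
        = (Uᴴ * (B * (U' * U'ᴴ) * Bᴴ * U)).trace := by simp only [Matrix.mul_assoc]
      _ = (B * (U' * U'ᴴ) * Bᴴ * (U * Uᴴ)).trace := by
        rw [trace_mul_comm]; simp only [Matrix.mul_assoc]
      _ = _ := by rw [h1, h2, Matrix.mul_one, Matrix.mul_one]
  exact_mod_cast this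

variable {V Q : Type*} {s t : Q → V} {ι : V → Type*} [∀ i, Fintype (ι i)] [∀ i, DecidableEq (ι i)]

/-- A change of basis at every vertex. -/
abbrev Frame {V : Type*} (ι : V → Type*) [∀ i, Fintype (ι i)] [∀ i, DecidableEq (ι i)] :=
  ∀ i, (Matrix (ι i) (ι i) ℂ)ˣ

namespace Frame

/-- A tuple of unitary matrices as a change of basis. -/
def ofUnitary (U : ∀ i, unitaryGroup (ι i) ℂ) : Frame ι := fun i => Unitary.toUnits (U i)

/-- The diagonal change of basis with entries `exp (-x / 2)`. -/
noncomputable def expDiag (x : (Σ i, ι i) → ℝ) : Frame ι := fun i =>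
  { val := diagonal fun a => (exp (-x ⟨i, a⟩ / 2) : ℂ)
    inv := diagonal fun a => (exp (x ⟨i, a⟩ / 2) : ℂ)
    val_inv := by
      rw [diagonal_mul_diagonal, ← diagonal_one]
      congr 1; ext a
      rw [← Complex.ofReal_mul, ← Real.exp_add, neg_div, neg_add_cancel]
      simp
    inv_val := by
      rw [diagonal_mul_diagonal, ← diagonal_one]
      congr 1; ext a
      rw [← Complex.ofReal_mul, ← Real.exp_add, neg_div, add_neg_cancel]
      simp }

/-- The matrices of a representation in a new basis. -/
def conj (A : ∀ e, Matrix (ι (t e)) (ι (s e)) ℂ) (g : Frame ι) (e : Q) :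
    Matrix (ι (t e)) (ι (s e)) ℂ :=
  ((g (t e))⁻¹).val * A e * (g (s e)).val

theorem conj_mul (A : ∀ e, Matrix (ι (t e)) (ι (s e)) ℂ) (g h : Frame ι) :
    conj A (g * h) = conj (conj A g) h := by
  ext1 e
  simp [conj, Matrix.mul_assoc]

theorem conj_ofUnitary (A : ∀ e, Matrix (ι (t e)) (ι (s e)) ℂ) (U : ∀ i, unitaryGroup (ι i) ℂ)
    (e : Q) : conj A (ofUnitary U) e = (U (t e)).valᴴ * A e * (U (s e)).val := rfl

theorem norm_sq_conj_expDiag (A : ∀ e, Matrix (ι (t e)) (ι (s e)) ℂ) (x : (Σ i, ι i) → ℝ) (e : Q)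
    (b : ι (t e)) (a : ι (s e)) :
    ‖conj A (expDiag x) e b a‖ ^ 2 = ‖A e b a‖ ^ 2 * exp (x ⟨t e, b⟩ - x ⟨s e, a⟩) := by
  have : conj A (expDiag x) e b a
      = (exp (x ⟨t e, b⟩ / 2) : ℂ) * A e b a * (exp (-x ⟨s e, a⟩ / 2) : ℂ) := by
    exact (mul_diagonal _ _ _ _).trans (congrArg (· * _) (diagonal_mul _ _ _ _))
  rw [this, norm_mul, norm_mul, Complex.norm_real, Complex.norm_real, Real.norm_eq_abs,
    Real.norm_eq_abs, abs_exp, abs_exp, mul_pow, mul_pow, ← Real.exp_nat_mul, ← Real.exp_nat_mul,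
    mul_right_comm, mul_comm, ← Real.exp_add]
  congr 2
  push_cast
  ring

theorem log_norm_det_expDiag (x : (Σ i, ι i) → ℝ) (i : V) :
    log (‖(expDiag x i).val.det‖ ^ 2) = -∑ a, x ⟨i, a⟩ := by
  have : (expDiag x i).val.det = (exp (∑ a, -x ⟨i, a⟩ / 2) : ℂ) := by
    change (diagonal _).det = _
    rw [det_diagonal, Real.exp_sum]
    push_cast
    rfl
  rw [this, Complex.norm_real, Real.norm_eq_abs, abs_exp, log_pow, log_exp, ← Finset.sum_div,
    Finset.sum_neg_distrib]
  push_cast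
  ring

/-- Every change of basis factors as unitary, positive diagonal, unitary. -/
theorem exists_eq_mul (g : Frame ι) : ∃ (U : ∀ i, unitaryGroup (ι i) ℂ) (x : (Σ i, ι i) → ℝ)
    (U' : ∀ i, unitaryGroup (ι i) ℂ), g = ofUnitary U * expDiag x * ofUnitary U' := by
  have hpd : ∀ i, ((g i).val * (g i).valᴴ).PosDef := fun i =>
    Matrix.PosDef.mul_conjTranspose_self _ (Matrix.vecMul_injective_of_isUnit (g i).isUnit)
  set U : ∀ i, unitaryGroup (ι i) ℂ := fun i => (hpd i).isHermitian.eigenvectorUnitary with hU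
  -- Chosen so that the square of `expDiag x` is the diagonal of eigenvalues of `g gᴴ`; the factor
  -- left over is then unitary.
  set x : (Σ i, ι i) → ℝ := fun p => -log ((hpd p.1).isHermitian.eigenvalues p.2) with hx
  set k : Frame ι := (ofUnitary U * expDiag x)⁻¹ * g with hk
  have hkU : ∀ i, (k i).val ∈ unitaryGroup (ι i) ℂ := by
    intro i
    have hspec := (hpd i).isHermitian.spectral_theorem
    rw [Unitary.conjStarAlgAut_apply] at hspec
    have hUU : (U i).valᴴ * (U i).val = 1 := mem_unitaryGroup_iff'.1 (U i).2
    have hkval : (k i).val = ((expDiag x i)⁻¹).val * (U i).valᴴ * (g i).val := by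
      simp only [hk, _root_.mul_inv_rev, Pi.mul_apply, Pi.inv_apply, Units.val_mul]
      rfl
    have hdiag : ((expDiag x i)⁻¹).valᴴ = ((expDiag x i)⁻¹).val := by
      change (diagonal _)ᴴ = diagonal _
      rw [diagonal_conjTranspose]
      congr 1
      ext a
      exact Complex.conj_ofReal _
    rw [mem_unitaryGroup_iff, star_eq_conjTranspose, hkval]
    simp only [conjTranspose_mul, conjTranspose_conjTranspose, hdiag]
    calc _ = ((expDiag x i)⁻¹).val * (U i).valᴴ * ((g i).val * (g i).valᴴ) * (U i).val *
          ((expDiag x i)⁻¹).val := by simp only [Matrix.mul_assoc]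
      _ = ((expDiag x i)⁻¹).val * ((U i).valᴴ * (U i).val) *
          diagonal (RCLike.ofReal ∘ (hpd i).isHermitian.eigenvalues) *
          ((U i).valᴴ * (U i).val) * ((expDiag x i)⁻¹).val := by
        conv_lhs => rw [hspec]
        simp only [Matrix.mul_assoc, hU, star_eq_conjTranspose]
      _ = 1 := by
        rw [hUU, Matrix.mul_one, Matrix.mul_one]
        change diagonal _ * diagonal _ * diagonal _ = _
        rw [diagonal_mul_diagonal, diagonal_mul_diagonal, ← diagonal_one]
        congr 1
        ext a
        have hpos := (hpd i).eigenvalues_pos a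
        have : (hpd i).isHermitian.eigenvalues a = exp (log ((hpd i).isHermitian.eigenvalues a)) :=
          (exp_log hpos).symm
        simp only [hx, Function.comp_apply]
        rw [this, Real.log_exp]
        change (_ : ℂ) * Complex.ofReal (exp _) * _ = 1
        rw [← Complex.ofReal_mul, ← Complex.ofReal_mul, ← Real.exp_add, ← Real.exp_add]
        ring_nf
        simp
  refine ⟨U, x, fun i => ⟨_, hkU i⟩, ?_⟩
  have : ofUnitary (fun i => (⟨_, hkU i⟩ : unitaryGroup (ι i) ℂ)) = k := by
    ext i : 2
    rfl
  rw [this, hk, mul_inv_cancel_left]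

variable [Fintype V] [Fintype Q]

/-- The Kempf–Ness function on the space of all bases. -/
noncomputable def energy (A : ∀ e, Matrix (ι (t e)) (ι (s e)) ℂ) (d : V → ℝ) (g : Frame ι) : ℝ :=
  ∑ e, frobSq (conj A g e) - ∑ i, d i * log (‖(g i).val.det‖ ^ 2)

/-- The squared absolute values of all matrix entries, as functions of a tuple of matrices which
we think of as unitary. -/
noncomputable def weight (A : ∀ e, Matrix (ι (t e)) (ι (s e)) ℂ) (m : Σ e, ι (t e) × ι (s e))
    (U : ∀ i, Matrix (ι i) (ι i) ℂ) : ℝ :=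
  ‖((U (t m.1))ᴴ * A m.1 * U (s m.1)) m.2.1 m.2.2‖ ^ 2

/-- The energy on the translate of a torus by a unitary frame. -/
noncomputable abbrev unitaryTorusEnergy (A : ∀ e, Matrix (ι (t e)) (ι (s e)) ℂ) (d : V → ℝ) :
    (∀ i, Matrix (ι i) (ι i) ℂ) → ((Σ i, ι i) → ℝ) → ℝ :=
  torusEnergy (weight A) (fun m : Σ e, ι (t e) × ι (s e) => (⟨t m.1, m.2.1⟩ : Σ i, ι i))
    (fun m => ⟨s m.1, m.2.2⟩) fun p => d p.1

/-- A diagonal frame scales each matrix entry by a character, giving the exponentials, while its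
log-determinants give the linear form. The unitary factor has determinant of modulus one, so only
`g` contributes to the constant. -/
theorem energy_mul_expDiag (A : ∀ e, Matrix (ι (t e)) (ι (s e)) ℂ) (d : V → ℝ) (g : Frame ι)
    (U : ∀ i, unitaryGroup (ι i) ℂ) (x : (Σ i, ι i) → ℝ) :
    energy A d (g * ofUnitary U * expDiag x) =
      unitaryTorusEnergy (conj A g) d (fun i => (U i).val) x
        - ∑ i, d i * log (‖(g i).val.det‖ ^ 2) := by
  have hdet : ∀ i, log (‖((g * ofUnitary U * expDiag x) i).val.det‖ ^ 2)
      = log (‖(g i).val.det‖ ^ 2) - ∑ a, x ⟨i, a⟩ := by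
    intro i
    have h1 : ‖(ofUnitary U i).val.det‖ = 1 := CStarRing.norm_of_mem_unitary (det_of_mem_unitary (U i).2)
    have h2 : ∀ h : Frame ι, ‖(h i).val.det‖ ^ 2 ≠ 0 := fun h =>
      pow_ne_zero _ (norm_ne_zero_iff.2 ((isUnit_iff_isUnit_det _).1 (h i).isUnit).ne_zero)
    rw [Pi.mul_apply, Pi.mul_apply, Units.val_mul, Units.val_mul, det_mul, det_mul, norm_mul,
      norm_mul, h1, mul_one, mul_pow, log_mul (h2 _) (h2 _), log_norm_det_expDiag, sub_eq_add_neg]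
  simp only [energy, hdet, mul_sub, Finset.sum_sub_distrib, unitaryTorusEnergy, torusEnergy,
    Fintype.sum_sigma, Fintype.sum_prod_type, weight, frobSq, conj_mul, norm_sq_conj_expDiag,
    conj_ofUnitary, Finset.mul_sum]
  ring

theorem energy_mul_unitary (A : ∀ e, Matrix (ι (t e)) (ι (s e)) ℂ) (d : V → ℝ) (g : Frame ι)
    (U : ∀ i, unitaryGroup (ι i) ℂ) : energy A d (g * ofUnitary U) = energy A d g := by
  have h1 : ∀ i, ‖(ofUnitary U i).val.det‖ = 1 := fun i =>
    CStarRing.norm_of_mem_unitary (det_of_mem_unitary (U i).2)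
  simp only [energy, conj_mul, conj_ofUnitary]
  congr 1
  · exact Finset.sum_congr rfl fun e _ => frobSq_mul_unitary (U _).2 (U _).2 _
  · refine Finset.sum_congr rfl fun i _ => ?_
    rw [Pi.mul_apply, Units.val_mul, det_mul, norm_mul, h1, mul_one]

/-- If the matrices satisfy the numerical stability condition in every unitary frame, then there is
a frame in which the moment map equation holds, here in the form of the vanishing of its pairing with
all diagonal matrices in all further unitary frames. -/
theorem exists_critical (A : ∀ e, Matrix (ι (t e)) (ι (s e)) ℂ) (d : V → ℝ)
    (hd : ∑ p : Σ i, ι i, d p.1 = 0)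
    (hstab : ∀ (U : ∀ i, unitaryGroup (ι i) ℂ) (x : (Σ i, ι i) → ℝ), (∃ p q, x p < x q) →
      (∀ e b a, conj A (ofUnitary U) e b a ≠ 0 → x ⟨t e, b⟩ ≤ x ⟨s e, a⟩) →
        0 < ∑ p : Σ i, ι i, d p.1 * x p) :
    ∃ g : Frame ι, ∀ (U : ∀ i, unitaryGroup (ι i) ℂ) (y : (Σ i, ι i) → ℝ),
      ∑ e, ∑ b, ∑ a, ‖((U (t e)).valᴴ * conj A g e * (U (s e)).val) b a‖ ^ 2 *
        (y ⟨t e, b⟩ - y ⟨s e, a⟩) + ∑ p : Σ i, ι i, d p.1 * y p = 0 := by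
  have hcont : ∀ (A : ∀ e, Matrix (ι (t e)) (ι (s e)) ℂ) m, Continuous (weight A m) := by
    intro A m
    unfold weight
    fun_prop
  obtain ⟨U₀, hU₀, x₀, hmin⟩ := exists_isMin_torusEnergy
    (W := weight A) (b := fun m : Σ e, ι (t e) × ι (s e) => (⟨t m.1, m.2.1⟩ : Σ i, ι i))
    (a := fun m => ⟨s m.1, m.2.2⟩) (c := fun p => d p.1)
    (K := Set.univ.pi fun i => {U : Matrix (ι i) (ι i) ℂ | U ∈ unitaryGroup (ι i) ℂ})
    (isCompact_univ_pi fun i => isCompact_unitaryGroup (ι i))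
    ⟨fun i => 1, fun i _ => one_mem (unitaryGroup (ι i) ℂ)⟩ (hcont A) (fun m U => by
      unfold weight; positivity) hd (by
      intro U hU x hx hle
      refine hstab (fun i => ⟨U i, hU i trivial⟩) x hx fun e b a hne => hle ⟨e, b, a⟩ ?_
      exact pow_ne_zero _ (norm_ne_zero_iff.2 hne))
  set g : Frame ι := ofUnitary (fun i => ⟨U₀ i, hU₀ i trivial⟩) * expDiag x₀ with hg
  -- By the factorisation of frames, the minimum over unitary matrices and tori is a global one.
  have hgmin : ∀ h, energy A d g ≤ energy A d h := by
    intro h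
    obtain ⟨U, x, U', rfl⟩ := exists_eq_mul h
    rw [energy_mul_unitary, hg, ← one_mul (ofUnitary U), ← one_mul (ofUnitary fun i => ⟨U₀ i, _⟩),
      energy_mul_expDiag, energy_mul_expDiag]
    have h1 : conj A 1 = A := by
      ext1 e
      simp [conj]
    rw [h1]
    exact sub_le_sub_right (hmin _ (fun i _ => (U i).2) x) _
  refine ⟨g, fun U y => ?_⟩
  -- Every torus translate through `g`, in whichever unitary frame, has its minimum at the origin,
  -- so the first derivative there vanishes.
  have hcrit := torusEnergy_critical (W := weight (conj A g))
    (b := fun m : Σ e, ι (t e) × ι (s e) => (⟨t m.1, m.2.1⟩ : Σ i, ι i))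
    (a := fun m => ⟨s m.1, m.2.2⟩) (c := fun p => d p.1) (k := fun i => (U i).val) (fun x => by
      have h := hgmin (g * ofUnitary U * expDiag x)
      have h0 : energy A d (g * ofUnitary U * expDiag 0) = energy A d g := by
        have : (expDiag (0 : (Σ i, ι i) → ℝ)) = 1 := by
          ext i : 2
          change diagonal _ = _
          simp
        rw [this, mul_one, energy_mul_unitary]
      rw [← h0, energy_mul_expDiag, energy_mul_expDiag] at h
      exact (sub_le_sub_iff_right _).1 h) y
  simpa only [Fintype.sum_sigma, Fintype.sum_prod_type, weight] using hcrit

end Frame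

end Frames

/-! ### Degrees and the numerical form of stability -/

namespace QuiverRep

variable {V : Type u} [Quiver.{v} V]

section Degree

variable [Fintype V]

/-- The degree of a representation with respect to weights at the vertices. -/
noncomputable def degree (d : V → ℝ) (E : QuiverRep.{u, v, w} V) : ℝ :=
  ∑ i, d i * (Module.finrank ℂ (E.obj i) : ℝ)

/-- The total dimension of a representation. -/
noncomputable def totalDim (E : QuiverRep.{u, v, w} V) : ℕ :=
  ∑ i, Module.finrank ℂ (E.obj i)

theorem totalDim_pos_iff (E : QuiverRep.{u, v, w} V) :
    0 < E.totalDim ↔ ∃ i, Nontrivial (E.obj i) := by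
  simp [totalDim, Finset.sum_pos_iff, Module.finrank_pos_iff]

/-- Comparing a slope with `μ` becomes reading off the sign of an expression linear in the
dimensions. -/
theorem degree_sub_const (θ : V → ℝ) (μ : ℝ) (E : QuiverRep.{u, v, w} V) (h : 0 < E.totalDim) :
    degree (fun i => θ i - μ) E = (slope θ E - μ) * E.totalDim := by
  have h' : (0 : ℝ) < E.totalDim := by exact_mod_cast h
  have h2 : slope θ E = (∑ i, θ i * (Module.finrank ℂ (E.obj i) : ℝ)) / E.totalDim := by
    simp [slope, totalDim]
  rw [h2, sub_mul, div_mul_cancel₀ _ h'.ne']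
  simp [degree, totalDim, sub_mul, Finset.sum_sub_distrib, Finset.mul_sum]

theorem degree_slope_eq_zero (θ : V → ℝ) (E : QuiverRep.{u, v, w} V) (h : 0 < E.totalDim) :
    degree (fun i => θ i - slope θ E) E = 0 := by
  rw [degree_sub_const _ _ _ h, sub_self, zero_mul]

theorem Subrep.totalDim_pos_iff {E : QuiverRep.{u, v, w} V} (F : Subrep E) :
    0 < F.toRep.totalDim ↔ ∃ i, F.carrier i ≠ ⊥ := by
  rw [QuiverRep.totalDim_pos_iff]
  exact exists_congr fun i => Submodule.nontrivial_iff_ne_bot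

theorem IsStable.degree_neg {θ : V → ℝ} {E : QuiverRep.{u, v, w} V} (hE : IsStable θ E)
    (F : Subrep E) (h₀ : ∃ i, F.carrier i ≠ ⊥) (h₁ : ∃ i, F.carrier i ≠ ⊤) :
    degree (fun i => θ i - slope θ E) F.toRep < 0 := by
  have h := F.totalDim_pos_iff.2 h₀
  rw [degree_sub_const _ _ _ h]
  exact mul_neg_of_neg_of_pos (sub_neg.2 (hE.2 F h₀ h₁)) (by exact_mod_cast h)

end Degree

section Sublevel

variable {E : QuiverRep.{u, v, w} V} {ι : V → Type*} [∀ i, Fintype (ι i)]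

/-- The subrepresentation spanned by the basis vectors of level at most `r`, where no edge map
raises the level. -/
def sublevel (c : ∀ i, Module.Basis (ι i) ℂ (E.obj i)) (x : (Σ i, ι i) → ℝ)
    (hx : ∀ {i j : V} (α : i ⟶ j) (a : ι i) (b : ι j),
      (c j).repr (E.map α (c i a)) b ≠ 0 → x ⟨j, b⟩ ≤ x ⟨i, a⟩) (r : ℝ) : Subrep E where
  carrier i := Submodule.span ℂ (Set.range fun a : {a // x ⟨i, a⟩ ≤ r} => c i a)
  map_mem {i j} α := by
    suffices h : Submodule.span ℂ (Set.range fun a : {a // x ⟨i, a⟩ ≤ r} => c i a) ≤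
        (Submodule.span ℂ (Set.range fun a : {a // x ⟨j, a⟩ ≤ r} => c j a)).comap (E.map α) from
      fun y hy => h hy
    rw [Submodule.span_le]
    rintro _ ⟨⟨a, ha⟩, rfl⟩
    change E.map α (c i a) ∈
      Submodule.span ℂ (Set.range fun a : {a // x ⟨j, a⟩ ≤ r} => c j a)
    rw [← (c j).sum_repr (E.map α (c i a))]
    refine Submodule.sum_mem _ fun b _ => ?_
    by_cases h : (c j).repr (E.map α (c i a)) b = 0
    · rw [h, zero_smul]
      exact Submodule.zero_mem _
    · exact Submodule.smul_mem _ _ (Submodule.subset_span ⟨⟨b, (hx α a b h).trans ha⟩, rfl⟩)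

theorem finrank_sublevel (c : ∀ i, Module.Basis (ι i) ℂ (E.obj i)) (x : (Σ i, ι i) → ℝ)
    (hx : ∀ {i j : V} (α : i ⟶ j) (a : ι i) (b : ι j),
      (c j).repr (E.map α (c i a)) b ≠ 0 → x ⟨j, b⟩ ≤ x ⟨i, a⟩) (r : ℝ) (i : V) :
    Module.finrank ℂ ((sublevel c x hx r).carrier i) = Fintype.card {a // x ⟨i, a⟩ ≤ r} :=
  finrank_span_eq_card ((c i).linearIndependent.comp _ Subtype.val_injective)

/-- The numerical form of stability in terms of bases. -/
theorem IsStable.sum_pos [Fintype V] {θ : V → ℝ} (hE : IsStable θ E)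
    (c : ∀ i, Module.Basis (ι i) ℂ (E.obj i)) {x : (Σ i, ι i) → ℝ} (hne : ∃ p q, x p < x q)
    (hx : ∀ {i j : V} (α : i ⟶ j) (a : ι i) (b : ι j),
      (c j).repr (E.map α (c i a)) b ≠ 0 → x ⟨j, b⟩ ≤ x ⟨i, a⟩) :
    0 < ∑ p : Σ i, ι i, (θ p.1 - slope θ E) * x p := by
  -- By Abel summation only sublevel sets matter, and the weight of a sublevel set is the degree of
  -- the subrepresentation its basis vectors span.
  refine sum_mul_pos_of_sublevel_neg ?_ hne fun r hp hq => ?_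
  · have := degree_slope_eq_zero θ E ((totalDim_pos_iff E).2 hE.1)
    rw [Fintype.sum_sigma]
    simpa only [degree, Module.finrank_eq_card_basis (c _), Finset.sum_const, Finset.card_univ,
      nsmul_eq_mul, mul_comm] using this
  · have h := hE.degree_neg (sublevel c x hx r) ?_ ?_
    · have hdim : ∀ i, Module.finrank ℂ ((sublevel c x hx r).toRep.obj i) =
          Fintype.card {a // x ⟨i, a⟩ ≤ r} := finrank_sublevel c x hx r
      simp only [degree, hdim] at h
      refine lt_of_eq_of_lt ?_ h
      rw [Finset.sum_filter, Fintype.sum_sigma]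
      refine Finset.sum_congr rfl fun i _ => ?_
      rw [← Finset.sum_filter]
      dsimp only
      rw [Finset.sum_const, nsmul_eq_mul, mul_comm, Fintype.card_subtype]
    · obtain ⟨⟨i, a⟩, hp⟩ := hp
      refine ⟨i, fun hbot => (c i).ne_zero a ?_⟩
      have : c i a ∈ (sublevel c x hx r).carrier i := Submodule.subset_span ⟨⟨a, hp⟩, rfl⟩
      rwa [hbot, Submodule.mem_bot] at this
    · obtain ⟨⟨i, a⟩, hq⟩ := hq
      refine ⟨i, fun htop => ?_⟩
      have h1 := finrank_sublevel c x hx r i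
      rw [htop, finrank_top, Module.finrank_eq_card_basis (c i)] at h1
      have h2 : Fintype.card {a // x ⟨i, a⟩ ≤ r} < Fintype.card (ι i) :=
        Fintype.card_subtype_lt (x := a) (not_le.2 hq)
      omega

end Sublevel

end QuiverRep

/-! ### King's equation and its solution on stable representations -/

/-- A representation of a quiver on finite-dimensional complex inner product spaces. -/
structure HermRep (V : Type u) [Quiver.{v} V] where
  /-- the inner product space at a vertex -/
  obj : V → Type w
  [normed : ∀ i, NormedAddCommGroup (obj i)]
  [innerProduct : ∀ i, InnerProductSpace ℂ (obj i)]
  [finite : ∀ i, FiniteDimensional ℂ (obj i)]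
  /-- the linear map along an edge -/
  map : ∀ {i j : V}, (i ⟶ j) → (obj i →ₗ[ℂ] obj j)

namespace HermRep

attribute [instance] HermRep.normed HermRep.innerProduct HermRep.finite

open QuiverRep Matrix

variable {V : Type u} [Quiver.{v} V]

/-- The underlying representation. -/
def toRep (H : HermRep.{u, v, w} V) : QuiverRep.{u, v, w} V where
  obj := H.obj
  map := H.map

variable [Fintype V] [∀ i j : V, Fintype (i ⟶ j)]

/-- The moment map equation with weights `d` (King's equation). -/
def IsKing (d : V → ℝ) (H : HermRep.{u, v, w} V) : Prop :=
  ∀ i, ∑ j, ∑ α : j ⟶ i, H.map α ∘ₗ LinearMap.adjoint (H.map α) -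
    ∑ j, ∑ α : i ⟶ j, LinearMap.adjoint (H.map α) ∘ₗ H.map α + (d i : ℂ) • LinearMap.id = 0

section Matrices

variable {ι : V → Type w} [∀ i, Fintype (ι i)] [∀ i, DecidableEq (ι i)]

/-- The hermitian representation given by a family of matrices. -/
noncomputable def ofMatrix (B : ∀ {i j : V}, (i ⟶ j) → Matrix (ι j) (ι i) ℂ) :
    HermRep.{u, v, w} V where
  obj i := EuclideanSpace ℂ (ι i)
  map α := toEuclideanLin (B α)

/-- The moment matrix at a vertex. -/
noncomputable def momentMatrix (B : ∀ {i j : V}, (i ⟶ j) → Matrix (ι j) (ι i) ℂ) (d : V → ℝ)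
    (i : V) : Matrix (ι i) (ι i) ℂ :=
  ∑ j, ∑ α : j ⟶ i, B α * (B α)ᴴ - ∑ j, ∑ α : i ⟶ j, (B α)ᴴ * B α + (d i : ℂ) • 1

theorem isKing_ofMatrix {B : ∀ {i j : V}, (i ⟶ j) → Matrix (ι j) (ι i) ℂ} {d : V → ℝ}
    (h : ∀ i, momentMatrix B d i = 0) : (ofMatrix B).IsKing d := by
  intro i
  have := congrArg (toEuclideanLin (𝕜 := ℂ)) (h i)
  simp only [momentMatrix, map_add, map_sub, map_sum, map_smul, map_zero, toLpLin_mul_same,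
    toEuclideanLin_conjTranspose_eq_adjoint, toLpLin_one] at this
  exact this

theorem momentMatrix_isHermitian (B : ∀ {i j : V}, (i ⟶ j) → Matrix (ι j) (ι i) ℂ) (d : V → ℝ)
    (i : V) : (momentMatrix B d i).IsHermitian := by
  simp [momentMatrix, Matrix.IsHermitian, conjTranspose_sum]

/-- If the pairing of the moment matrices with diagonal matrices vanishes in all unitary frames, then
the moment matrices vanish. -/
theorem momentMatrix_eq_zero {B : ∀ {i j : V}, (i ⟶ j) → Matrix (ι j) (ι i) ℂ} {d : V → ℝ}
    (h : ∀ (U : ∀ i, unitaryGroup (ι i) ℂ) (y : (Σ i, ι i) → ℝ),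
      ∑ i, ∑ j, ∑ α : i ⟶ j, ∑ b, ∑ a, ‖((U j).valᴴ * B α * (U i).val) b a‖ ^ 2 *
        (y ⟨j, b⟩ - y ⟨i, a⟩) + ∑ p : Σ i, ι i, d p.1 * y p = 0) (k : V) :
    momentMatrix B d k = 0 := by
  classical
  set M := momentMatrix B d k with hM
  have hH : M.IsHermitian := momentMatrix_isHermitian B d k
  -- Diagonalise the moment matrix at `k`. Pairing with the indicator of one basis vector then
  -- isolates one eigenvalue.
  set U : ∀ i, unitaryGroup (ι i) ℂ := Function.update 1 k hH.eigenvectorUnitary with hU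
  have hUk : U k = hH.eigenvectorUnitary := by simp [hU]
  set N : ∀ i j, (i ⟶ j) → ι j → ι i → ℝ :=
    fun i j α b a => ‖((U j).valᴴ * B α * (U i).val) b a‖ ^ 2 with hN
  have hreal : ∀ c : ι k, ∑ i, ∑ α : i ⟶ k, ∑ a, N i k α c a -
      ∑ j, ∑ α : k ⟶ j, ∑ b, N k j α b c + d k = 0 := by
    intro c
    have h1 := h U (Pi.single ⟨k, c⟩ 1)
    have e1 : ∑ i, ∑ j, ∑ α : i ⟶ j, ∑ b, ∑ a, N i j α b a *
        (Pi.single ⟨k, c⟩ 1 : (Σ i, ι i) → ℝ) ⟨j, b⟩ = ∑ i, ∑ α : i ⟶ k, ∑ a, N i k α c a := by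
      refine Finset.sum_congr rfl fun i _ => ?_
      rw [Finset.sum_eq_single k]
      · refine Finset.sum_congr rfl fun α _ => ?_
        rw [Finset.sum_eq_single c]
        · simp
        · intro b _ hb
          simp [hb]
        · simp
      · intro j _ hj
        simp [hj]
      · simp
    have e2 : ∑ i, ∑ j, ∑ α : i ⟶ j, ∑ b, ∑ a, N i j α b a *
        (Pi.single ⟨k, c⟩ 1 : (Σ i, ι i) → ℝ) ⟨i, a⟩ = ∑ j, ∑ α : k ⟶ j, ∑ b, N k j α b c := by
      rw [Finset.sum_eq_single k]
      · refine Finset.sum_congr rfl fun j _ => Finset.sum_congr rfl fun α _ =>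
          Finset.sum_congr rfl fun b _ => ?_
        rw [Finset.sum_eq_single c]
        · simp
        · intro a _ ha
          simp [ha]
        · simp
      · intro i _ hi
        simp [hi]
      · simp
    have e3 : ∑ p : Σ i, ι i, d p.1 * (Pi.single ⟨k, c⟩ 1 : (Σ i, ι i) → ℝ) p = d k := by
      simp [Pi.single_apply]
    rw [e3] at h1
    simp only [mul_sub, Finset.sum_sub_distrib] at h1
    rw [← e1, ← e2]
    exact h1
  have hdiag : ∀ c, ((U k).valᴴ * M * (U k).val) c c = 0 := by
    intro c
    have hUU : ∀ i, (U i).val * (U i).valᴴ = 1 := fun i => mem_unitaryGroup_iff.1 (U i).2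
    have hUU' : (U k).valᴴ * (U k).val = 1 := mem_unitaryGroup_iff'.1 (U k).2
    have h1 : ∀ i (α : i ⟶ k), ((U k).valᴴ * (B α * (B α)ᴴ) * (U k).val) c c
        = ((∑ a, N i k α c a : ℝ) : ℂ) := by
      intro i α
      have : (U k).valᴴ * (B α * (B α)ᴴ) * (U k).val =
          ((U k).valᴴ * B α * (U i).val) * ((U k).valᴴ * B α * (U i).val)ᴴ := by
        simp only [conjTranspose_mul, conjTranspose_conjTranspose, Matrix.mul_assoc]
        rw [← Matrix.mul_assoc (U i).val, hUU, Matrix.one_mul]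
      rw [this, mul_apply]
      simp [hN, Complex.mul_conj, Complex.normSq_eq_norm_sq]
    have h2 : ∀ j (α : k ⟶ j), ((U k).valᴴ * ((B α)ᴴ * B α) * (U k).val) c c
        = ((∑ b, N k j α b c : ℝ) : ℂ) := by
      intro j α
      have : (U k).valᴴ * ((B α)ᴴ * B α) * (U k).val =
          ((U j).valᴴ * B α * (U k).val)ᴴ * ((U j).valᴴ * B α * (U k).val) := by
        simp only [conjTranspose_mul, conjTranspose_conjTranspose, Matrix.mul_assoc]
        rw [← Matrix.mul_assoc (U j).val, hUU, Matrix.one_mul]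
      rw [this, mul_apply]
      simp [hN, Complex.conj_mul']
    have h3 : (U k).valᴴ * M * (U k).val =
        ∑ j, ∑ α : j ⟶ k, (U k).valᴴ * (B α * (B α)ᴴ) * (U k).val -
          ∑ j, ∑ α : k ⟶ j, (U k).valᴴ * ((B α)ᴴ * B α) * (U k).val + (d k : ℂ) • 1 := by
      rw [hM, momentMatrix]
      simp only [Matrix.mul_add, Matrix.mul_sub, Matrix.add_mul, Matrix.sub_mul, Matrix.mul_sum,
        Matrix.sum_mul, Matrix.mul_smul, Matrix.smul_mul, Matrix.mul_one, hUU']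
    rw [h3, Matrix.add_apply, Matrix.sub_apply, Matrix.smul_apply, Matrix.one_apply_eq]
    simp only [Matrix.sum_apply, h1, h2, smul_eq_mul, mul_one]
    exact_mod_cast congrArg Complex.ofReal (hreal c)
  rw [← hH.eigenvalues_eq_zero_iff]
  ext c
  have h1 := hH.conjStarAlgAut_star_eigenvectorUnitary
  rw [Unitary.conjStarAlgAut_star_apply, ← hUk] at h1
  have h2 := congrFun (congrFun h1 c) c
  rw [diagonal_apply_eq] at h2
  have h3 := h2.symm.trans (hdiag c)
  simpa using h3

end Matrices

/-- A stable representation carries a metric that satisfies the moment map equation. -/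
theorem exists_isKing_of_isStable {θ : V → ℝ} {E : QuiverRep.{u, v, w} V} (hE : E.IsStable θ) :
    ∃ H : HermRep.{u, v, w} V, H.IsKing (fun i => θ i - slope θ E) ∧ Nonempty (Iso E H.toRep) := by
  classical
  -- The lift keeps the coordinate spaces in the universe of `E`.
  let ι : V → Type w := fun i => ULift.{w} (Fin (Module.finrank ℂ (E.obj i)))
  let c : ∀ i, Module.Basis (ι i) ℂ (E.obj i) := fun i =>
    (Module.finBasis ℂ (E.obj i)).reindex Equiv.ulift.symm
  let s : (Σ i j : V, i ⟶ j) → V := fun e => e.1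
  let t : (Σ i j : V, i ⟶ j) → V := fun e => e.2.1
  let A : ∀ e, Matrix (ι (t e)) (ι (s e)) ℂ := fun e =>
    LinearMap.toMatrix (c (s e)) (c (t e)) (E.map e.2.2)
  let T : ∀ (g : Frame ι) (i : V), E.obj i ≃ₗ[ℂ] (ι i → ℂ) := fun g i =>
    (c i).equivFun ≪≫ₗ toLin'OfInv (g i).mul_inv (g i).inv_mul
  have hT : ∀ (g : Frame ι) {i j : V} (α : i ⟶ j) (x : E.obj i),
      T g j (E.map α x) = Frame.conj A g ⟨i, j, α⟩ *ᵥ T g i x := by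
    intro g i j α x
    have h1 : ∀ k (z : E.obj k), T g k z = ((g k)⁻¹).val *ᵥ ⇑((c k).repr z) := fun k z => rfl
    have h2 : A ⟨i, j, α⟩ *ᵥ ⇑((c i).repr x) = ⇑((c j).repr (E.map α x)) :=
      LinearMap.toMatrix_mulVec_repr (c i) (c j) (E.map α) x
    rw [h1, h1, ← h2, Frame.conj, mulVec_mulVec, mulVec_mulVec]
    congr 1
    change _ = (_ * A ⟨i, j, α⟩ * (g i).val) * ((g i)⁻¹).val
    rw [Matrix.mul_assoc, Units.mul_inv, Matrix.mul_one]
  obtain ⟨g, hg⟩ := Frame.exists_critical A (fun i => θ i - slope θ E) (by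
      have := degree_slope_eq_zero θ E ((totalDim_pos_iff E).2 hE.1)
      rw [Fintype.sum_sigma]
      simpa only [degree, Module.finrank_eq_card_basis (c _), Finset.sum_const, Finset.card_univ,
        nsmul_eq_mul, mul_comm] using this) (by
      intro U x hne hx
      -- In the basis defined by the unitary frame, the coefficients of the edge maps are the
      -- entries of the conjugated matrices.
      refine hE.sum_pos (fun i => Module.Basis.ofEquivFun (T (Frame.ofUnitary U) i)) hne ?_
      intro i j α a b hab
      refine hx ⟨i, j, α⟩ b a fun h0 => hab ?_
      rw [Module.Basis.ofEquivFun_repr_apply, hT, Module.Basis.coe_ofEquivFun,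
        LinearEquiv.apply_symm_apply, mulVec_single_one]
      exact h0)
  refine ⟨ofMatrix fun {i j} α => Frame.conj A g ⟨i, j, α⟩, isKing_ofMatrix fun k => ?_,
    ⟨⟨fun i => T g i ≪≫ₗ (WithLp.linearEquiv 2 ℂ (ι i → ℂ)).symm, fun {i j} α x => ?_⟩⟩⟩
  · refine momentMatrix_eq_zero (fun U y => ?_) k
    simpa only [Fintype.sum_sigma] using hg U y
  · exact congrArg (WithLp.toLp 2) (hT g α x)

end HermRep

/-! ### Traces, orthogonal projections and off-diagonal parts -/

section Trace

variable {E F : Type*} [NormedAddCommGroup E] [InnerProductSpace ℂ E] [FiniteDimensional ℂ E]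
  [NormedAddCommGroup F] [InnerProductSpace ℂ F] [FiniteDimensional ℂ F]

theorem LinearMap.trace_comp_adjoint (g : E →ₗ[ℂ] F) :
    LinearMap.trace ℂ F (g ∘ₗ LinearMap.adjoint g) =
      ((∑ k, ‖LinearMap.adjoint g (stdOrthonormalBasis ℂ F k)‖ ^ 2 : ℝ) : ℂ) := by
  rw [LinearMap.trace_eq_sum_inner _ (stdOrthonormalBasis ℂ F)]
  push_cast
  refine Finset.sum_congr rfl fun k _ => ?_
  rw [Function.comp_apply, ← LinearMap.adjoint_inner_left, inner_self_eq_norm_sq_to_K]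
  rfl

theorem LinearMap.trace_comp_adjoint_re_nonneg (g : E →ₗ[ℂ] F) :
    0 ≤ (LinearMap.trace ℂ F (g ∘ₗ LinearMap.adjoint g)).re := by
  rw [LinearMap.trace_comp_adjoint, Complex.ofReal_re]
  positivity

theorem LinearMap.eq_zero_of_trace_comp_adjoint_re {g : E →ₗ[ℂ] F}
    (h : (LinearMap.trace ℂ F (g ∘ₗ LinearMap.adjoint g)).re = 0) : g = 0 := by
  rw [LinearMap.trace_comp_adjoint, Complex.ofReal_re,
    Finset.sum_eq_zero_iff_of_nonneg fun _ _ => by positivity] at h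
  have : LinearMap.adjoint g = 0 := by
    refine (stdOrthonormalBasis ℂ F).toBasis.ext fun k => ?_
    simpa using h k (Finset.mem_univ _)
  rw [← LinearMap.adjoint_adjoint g, this, map_zero]

/-- The orthogonal projection as a linear endomorphism. -/
noncomputable def Submodule.orthProj (K : Submodule ℂ E) : E →ₗ[ℂ] E :=
  K.starProjection.toLinearMap

theorem Submodule.orthProj_adjoint (K : Submodule ℂ E) :
    LinearMap.adjoint K.orthProj = K.orthProj :=
  LinearMap.IsSymmetric.adjoint_eq K.starProjection_isSymmetric

theorem Submodule.orthProj_isProj (K : Submodule ℂ E) : LinearMap.IsProj K K.orthProj :=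
  ⟨fun x => K.starProjection_apply_mem x, fun _ hx => Submodule.starProjection_eq_self_iff.2 hx⟩

theorem Submodule.trace_orthProj (K : Submodule ℂ E) :
    LinearMap.trace ℂ E K.orthProj = Module.finrank ℂ K :=
  K.orthProj_isProj.trace

theorem Submodule.orthProj_comp_self (K : Submodule ℂ E) : K.orthProj ∘ₗ K.orthProj = K.orthProj :=
  LinearMap.ext fun x => K.orthProj_isProj.2 _ (K.orthProj_isProj.1 x)

/-- The part of `f` that maps the orthogonal complement of `K` into `L`. -/
noncomputable def LinearMap.offDiag (f : E →ₗ[ℂ] F) (K : Submodule ℂ E) (L : Submodule ℂ F) :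
    E →ₗ[ℂ] F :=
  L.orthProj ∘ₗ f ∘ₗ (LinearMap.id - K.orthProj)

theorem LinearMap.map_orthogonal_of_offDiag_eq_zero {f : E →ₗ[ℂ] F} {K : Submodule ℂ E}
    {L : Submodule ℂ F} (h : f.offDiag K L = 0) : ∀ x ∈ Kᗮ, f x ∈ Lᗮ := by
  intro x hx
  have h1 := LinearMap.congr_fun h x
  have h2 : K.orthProj x = 0 := (Submodule.starProjection_apply_eq_zero_iff _).2 hx
  simp only [LinearMap.offDiag, LinearMap.comp_apply, LinearMap.sub_apply, LinearMap.id_apply, h2,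
    sub_zero, LinearMap.zero_apply] at h1
  exact (Submodule.starProjection_apply_eq_zero_iff _).1 h1

/-- Insert the identity of `E` as projection to `K` plus complementary projection between `f` and
its adjoint. On the `K` part the projection to `L` is redundant because `f` maps `K` into `L`;
cyclicity of the trace does the rest. -/
theorem LinearMap.trace_offDiag {f : E →ₗ[ℂ] F} {K : Submodule ℂ E} {L : Submodule ℂ F}
    (h : ∀ x ∈ K, f x ∈ L) :
    LinearMap.trace ℂ F (f.offDiag K L ∘ₗ LinearMap.adjoint (f.offDiag K L)) =
      LinearMap.trace ℂ F (L.orthProj ∘ₗ f ∘ₗ LinearMap.adjoint f) -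
        LinearMap.trace ℂ E (K.orthProj ∘ₗ LinearMap.adjoint f ∘ₗ f) := by
  have hf : L.orthProj ∘ₗ f ∘ₗ K.orthProj = f ∘ₗ K.orthProj :=
    LinearMap.ext fun x => L.orthProj_isProj.2 _ (h _ (K.orthProj_isProj.1 x))
  have h1 : LinearMap.trace ℂ E (K.orthProj ∘ₗ LinearMap.adjoint f ∘ₗ f) =
      LinearMap.trace ℂ F (f ∘ₗ K.orthProj ∘ₗ LinearMap.adjoint f) := by
    rw [← LinearMap.comp_assoc, LinearMap.trace_comp_comm']
  set q : E →ₗ[ℂ] E := LinearMap.id - K.orthProj with hq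
  have hqadj : LinearMap.adjoint q = q := by
    rw [hq, map_sub, LinearMap.adjoint_id, K.orthProj_adjoint]
  have hqq : q ∘ₗ q = q := by
    rw [hq]
    simp only [LinearMap.sub_comp, LinearMap.comp_sub, LinearMap.id_comp, LinearMap.comp_id,
      K.orthProj_comp_self]
    abel
  have h2 : LinearMap.trace ℂ F (f.offDiag K L ∘ₗ LinearMap.adjoint (f.offDiag K L)) =
      LinearMap.trace ℂ F (L.orthProj ∘ₗ f ∘ₗ q ∘ₗ LinearMap.adjoint f) := by
    rw [LinearMap.offDiag, ← hq]
    simp only [LinearMap.adjoint_comp, hqadj, L.orthProj_adjoint]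
    calc _ = LinearMap.trace ℂ F
          ((L.orthProj ∘ₗ f ∘ₗ (q ∘ₗ q) ∘ₗ LinearMap.adjoint f) ∘ₗ L.orthProj) := by
            simp only [LinearMap.comp_assoc]
      _ = LinearMap.trace ℂ F
          ((L.orthProj ∘ₗ L.orthProj) ∘ₗ f ∘ₗ q ∘ₗ LinearMap.adjoint f) := by
            rw [LinearMap.trace_comp_comm', hqq]
            simp only [LinearMap.comp_assoc]
      _ = _ := by rw [L.orthProj_comp_self]
  rw [h1, h2, hq, ← map_sub]
  congr 1
  simp only [LinearMap.sub_comp, LinearMap.comp_sub, LinearMap.id_comp]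
  congr 1
  rw [← LinearMap.comp_assoc, ← LinearMap.comp_assoc, LinearMap.comp_assoc _ f, hf,
    LinearMap.comp_assoc]

end Trace

/-! ### Isomorphisms and polystability of prescribed slope -/

namespace QuiverRep

variable {V : Type u} [Quiver.{v} V]

namespace Iso

/-- The inverse isomorphism. -/
def symm {E : QuiverRep.{u, v, w₁} V} {F : QuiverRep.{u, v, w₂} V} (e : Iso E F) : Iso F E where
  equiv i := (e.equiv i).symm
  comm α x := by
    apply (e.equiv _).injective
    rw [e.comm, LinearEquiv.apply_symm_apply, LinearEquiv.apply_symm_apply]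

/-- Composition of isomorphisms. -/
def trans {E : QuiverRep.{u, v, w} V} {F : QuiverRep.{u, v, w₁} V} {G : QuiverRep.{u, v, w₂} V}
    (e : Iso E F) (f : Iso F G) : Iso E G where
  equiv i := e.equiv i ≪≫ₗ f.equiv i
  comm α x := by
    simp only [LinearEquiv.trans_apply, e.comm, f.comm]

/-- The direct sum of isomorphisms. -/
def directSum {ι : Type} [Fintype ι] {S : ι → QuiverRep.{u, v, w₁} V}
    {T : ι → QuiverRep.{u, v, w₂} V} (e : ∀ k, Iso (S k) (T k)) :
    Iso (QuiverRep.directSum S) (QuiverRep.directSum T) where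
  equiv i := LinearEquiv.piCongrRight fun k => (e k).equiv i
  comm α x := funext fun k => (e k).comm α (x k)

/-- Reindexing a direct sum. -/
def directSumReindex {ι κ : Type} [Fintype ι] [Fintype κ] (e : κ ≃ ι)
    (S : ι → QuiverRep.{u, v, w} V) :
    Iso (QuiverRep.directSum S) (QuiverRep.directSum fun k => S (e k)) where
  equiv i := (LinearEquiv.piCongrLeft ℂ (fun k => (S k).obj i) e).symm
  comm _ _ := rfl

/-- A representation that is the internal direct sum of two subrepresentations. -/
noncomputable def ofIsCompl {E : QuiverRep.{u, v, w} V} {F G : Subrep E}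
    (h : ∀ i, IsCompl (F.carrier i) (G.carrier i)) {ι κ : Type} [Fintype ι] [Fintype κ]
    {S : ι → QuiverRep.{u, v, w} V} {T : κ → QuiverRep.{u, v, w} V}
    (e : Iso F.toRep (QuiverRep.directSum S)) (f : Iso G.toRep (QuiverRep.directSum T)) :
    Iso (QuiverRep.directSum (Sum.elim S T)) E where
  equiv i := LinearEquiv.sumPiEquivProdPi ℂ ι κ (fun k => (Sum.elim S T k).obj i) ≪≫ₗ
    ((e.equiv i).symm.prodCongr (f.equiv i).symm) ≪≫ₗ
      Submodule.prodEquivOfIsCompl _ _ (h i)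
  comm {i j} α x := by
    have h1 := e.symm.comm α fun k => x (Sum.inl k)
    have h2 := f.symm.comm α fun k => x (Sum.inr k)
    have h3 := congrArg₂ (· + ·) (congrArg Subtype.val h1) (congrArg Subtype.val h2)
    refine Eq.trans h3 ?_
    exact (map_add (E.map α) _ _).symm

end Iso

/-- Polystability of prescribed slope, with an arbitrary finite index type. -/
def IsPolystableOfSlope [Fintype V] (θ : V → ℝ) (μ : ℝ) (E : QuiverRep.{u, v, w} V) : Prop :=
  ∃ (ι : Type) (_ : Fintype ι) (S : ι → QuiverRep.{u, v, w} V),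
    (∀ k, IsStable θ (S k) ∧ slope θ (S k) = μ) ∧ Nonempty (Iso E (directSum S))

theorem IsPolystableOfSlope.isPolystable [Fintype V] {θ : V → ℝ} {μ : ℝ}
    {E : QuiverRep.{u, v, w} V} (h : E.IsPolystableOfSlope θ μ) : E.IsPolystable θ := by
  obtain ⟨ι, _, S, hS, ⟨e⟩⟩ := h
  let f := (Fintype.equivFin ι).symm
  exact ⟨Fintype.card ι, fun k => S (f k), fun k => (hS _).1,
    fun k l => (hS _).2.trans (hS _).2.symm, ⟨e.trans (Iso.directSumReindex f S)⟩⟩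

theorem IsPolystableOfSlope.of_iso [Fintype V] {θ : V → ℝ} {μ : ℝ}
    {E F : QuiverRep.{u, v, w} V} (h : F.IsPolystableOfSlope θ μ) (e : Iso E F) :
    E.IsPolystableOfSlope θ μ := by
  obtain ⟨ι, _, S, hS, ⟨f⟩⟩ := h
  exact ⟨ι, _, S, hS, ⟨e.trans f⟩⟩

end QuiverRep

/-! ### Adjoints of restrictions and of orthogonal sums -/

section Adjoint

variable {E F : Type*} [NormedAddCommGroup E] [InnerProductSpace ℂ E] [FiniteDimensional ℂ E]
  [NormedAddCommGroup F] [InnerProductSpace ℂ F] [FiniteDimensional ℂ F]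

/-- In general a projection onto `K` would appear on the right; `h'` makes it unnecessary. -/
theorem LinearMap.coe_adjoint_restrict (f : E →ₗ[ℂ] F) {K : Submodule ℂ E} {L : Submodule ℂ F}
    (h : ∀ x ∈ K, f x ∈ L) (h' : ∀ y ∈ L, LinearMap.adjoint f y ∈ K) (y : L) :
    (LinearMap.adjoint (f.restrict h) y : E) = LinearMap.adjoint f y := by
  have : (LinearMap.adjoint f).restrict h' = LinearMap.adjoint (f.restrict h) := by
    rw [LinearMap.eq_adjoint_iff]
    intro y x
    exact LinearMap.adjoint_inner_left f (x : E) (y : F)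
  rw [← this]
  rfl

theorem LinearMap.adjoint_mem_orthogonal {f : E →ₗ[ℂ] F} {K : Submodule ℂ E} {L : Submodule ℂ F}
    (h : ∀ x ∈ K, f x ∈ L) : ∀ y ∈ Lᗮ, LinearMap.adjoint f y ∈ Kᗮ := by
  intro y hy
  rw [Submodule.mem_orthogonal]
  intro x hx
  rw [LinearMap.adjoint_inner_right]
  exact (Submodule.mem_orthogonal _ _).1 hy _ (h x hx)

theorem LinearMap.comp_finset_sum {R M N P κ : Type*} [CommSemiring R] [AddCommMonoid M]
    [AddCommMonoid N] [AddCommMonoid P] [Module R M] [Module R N] [Module R P] (g : N →ₗ[R] P)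
    (s : Finset κ) (f : κ → M →ₗ[R] N) : g ∘ₗ ∑ k ∈ s, f k = ∑ k ∈ s, g ∘ₗ f k :=
  LinearMap.ext fun x => by simp

/-- The product of linear maps, on `ℓ²` direct sums. -/
noncomputable def LinearMap.piLpMap {κ : Type*} [Fintype κ] {E F : κ → Type*}
    [∀ k, NormedAddCommGroup (E k)] [∀ k, InnerProductSpace ℂ (E k)]
    [∀ k, NormedAddCommGroup (F k)] [∀ k, InnerProductSpace ℂ (F k)]
    (f : ∀ k, E k →ₗ[ℂ] F k) : PiLp 2 E →ₗ[ℂ] PiLp 2 F :=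
  (WithLp.linearEquiv 2 ℂ (∀ k, F k)).symm.toLinearMap ∘ₗ LinearMap.piMap f ∘ₗ
    (WithLp.linearEquiv 2 ℂ (∀ k, E k)).toLinearMap

theorem LinearMap.adjoint_piLpMap {κ : Type*} [Fintype κ] {E F : κ → Type*}
    [∀ k, NormedAddCommGroup (E k)] [∀ k, InnerProductSpace ℂ (E k)]
    [∀ k, FiniteDimensional ℂ (E k)]
    [∀ k, NormedAddCommGroup (F k)] [∀ k, InnerProductSpace ℂ (F k)]
    [∀ k, FiniteDimensional ℂ (F k)] (f : ∀ k, E k →ₗ[ℂ] F k) :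
    LinearMap.adjoint (LinearMap.piLpMap f) = LinearMap.piLpMap fun k => LinearMap.adjoint (f k) := by
  symm
  rw [LinearMap.eq_adjoint_iff]
  intro x y
  rw [PiLp.inner_apply, PiLp.inner_apply]
  exact Finset.sum_congr rfl fun k _ => LinearMap.adjoint_inner_left (f k) (y k) (x k)

end Adjoint

/-! ### From King's equation to polystability -/

namespace HermRep

open QuiverRep

variable {V : Type u} [Quiver.{v} V]

/-- The restriction to a family of subspaces preserved by the edge maps. -/
noncomputable def sub (H : HermRep.{u, v, w} V) (K : ∀ i, Submodule ℂ (H.obj i))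
    (hK : ∀ {i j : V} (α : i ⟶ j), ∀ x ∈ K i, H.map α x ∈ K j) : HermRep.{u, v, w} V where
  obj i := K i
  map α := (H.map α).restrict (hK α)

/-- The orthogonal direct sum. -/
noncomputable def directSum {κ : Type} [Fintype κ] (H : κ → HermRep.{u, v, w} V) :
    HermRep.{u, v, w} V where
  obj i := PiLp 2 fun k => (H k).obj i
  map α := LinearMap.piLpMap fun k => (H k).map α

/-- The direct sum of the underlying representations. -/
noncomputable def directSumIso {κ : Type} [Fintype κ] (H : κ → HermRep.{u, v, w} V) :
    Iso (QuiverRep.directSum fun k => (H k).toRep) (directSum H).toRep where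
  equiv i := (WithLp.linearEquiv 2 ℂ (∀ k, (H k).obj i)).symm
  comm _ _ := rfl

variable [Fintype V] [∀ i j : V, Fintype (i ⟶ j)]

/-- The moment map equation descends along jointly injective families of maps that commute with the
edge maps and their adjoints. -/
theorem isKing_of_jointly_injective {κ : Type*} {d : V → ℝ} {G : HermRep.{u, v, w₁} V}
    {H : κ → HermRep.{u, v, w₂} V} (hH : ∀ k, (H k).IsKing d)
    (p : ∀ k i, G.obj i →ₗ[ℂ] (H k).obj i)
    (hmap : ∀ k {i j : V} (α : i ⟶ j) x, p k j (G.map α x) = (H k).map α (p k i x))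
    (hadj : ∀ k {i j : V} (α : i ⟶ j) y, p k i (LinearMap.adjoint (G.map α) y) =
      LinearMap.adjoint ((H k).map α) (p k j y))
    (hinj : ∀ i x, (∀ k, p k i x = 0) → x = 0) : G.IsKing d := by
  intro i
  refine LinearMap.ext fun x => hinj i _ fun k => ?_
  have h := LinearMap.congr_fun (hH k i) (p k i x)
  simp only [LinearMap.add_apply, LinearMap.sub_apply, LinearMap.sum_apply,
    LinearMap.smul_apply, LinearMap.id_apply, LinearMap.coe_comp, Function.comp_apply,
    map_add, map_sub, map_sum, map_smul, hmap, hadj] at h ⊢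
  exact h

theorem IsKing.sub {d : V → ℝ} {H : HermRep.{u, v, w} V} (hH : H.IsKing d)
    {K : ∀ i, Submodule ℂ (H.obj i)} (hK : ∀ {i j : V} (α : i ⟶ j), ∀ x ∈ K i, H.map α x ∈ K j)
    (hK' : ∀ {i j : V} (α : i ⟶ j), ∀ y ∈ K j, LinearMap.adjoint (H.map α) y ∈ K i) :
    (H.sub K hK).IsKing d :=
  isKing_of_jointly_injective (κ := Unit) (fun _ => hH) (fun _ i => (K i).subtype)
    (fun _ _ _ _ _ => rfl)
    (fun _ _ _ α y => LinearMap.coe_adjoint_restrict (H.map α) (hK α) (hK' α) y)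
    (fun _ _ h => Subtype.ext (h ()))

theorem IsKing.directSum {κ : Type} [Fintype κ] {d : V → ℝ} {H : κ → HermRep.{u, v, w} V}
    (hH : ∀ k, (H k).IsKing d) : (HermRep.directSum H).IsKing d :=
  isKing_of_jointly_injective hH
    (fun k i => LinearMap.proj k ∘ₗ (WithLp.linearEquiv 2 ℂ (∀ k, (H k).obj i)).toLinearMap)
    (fun _ _ _ _ _ => rfl)
    (fun k i _ α y => congrArg (fun z : PiLp 2 fun k => (H k).obj i => z k)
      (LinearMap.congr_fun (LinearMap.adjoint_piLpMap fun k => (H k).map α) y))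
    (fun _ _ h => PiLp.ext h)

/-- The degree of a subrepresentation of a solution of the moment map equation measures the failure
of the orthogonal complement to be a subrepresentation. -/
theorem IsKing.degree_sub {d : V → ℝ} {H : HermRep.{u, v, w} V} (hH : H.IsKing d)
    {K : ∀ i, Submodule ℂ (H.obj i)}
    (hK : ∀ {i j : V} (α : i ⟶ j), ∀ x ∈ K i, H.map α x ∈ K j) :
    ∑ i, d i * (Module.finrank ℂ (K i) : ℝ) = -∑ i, ∑ j, ∑ α : i ⟶ j, (LinearMap.trace ℂ (H.obj j)
      ((H.map α).offDiag (K i) (K j) ∘ₗ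
        LinearMap.adjoint ((H.map α).offDiag (K i) (K j)))).re := by
  have h : ∀ i, ∑ j, ∑ α : j ⟶ i, LinearMap.trace ℂ (H.obj i)
        ((K i).orthProj ∘ₗ H.map α ∘ₗ LinearMap.adjoint (H.map α)) -
      ∑ j, ∑ α : i ⟶ j, LinearMap.trace ℂ (H.obj i)
        ((K i).orthProj ∘ₗ LinearMap.adjoint (H.map α) ∘ₗ H.map α) +
      (d i : ℂ) * (Module.finrank ℂ (K i) : ℂ) = 0 := by
    intro i
    -- The trace of King's equation against the projection onto `K i`. Summed over vertices, each
    -- edge contributes once at its head and once at its tail, and the difference is the trace of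
    -- its off-diagonal part.
    have h1 := congrArg (fun f => LinearMap.trace ℂ (H.obj i) ((K i).orthProj ∘ₗ f)) (hH i)
    simpa only [LinearMap.comp_add, LinearMap.comp_sub, LinearMap.comp_finset_sum, LinearMap.comp_smul,
      LinearMap.comp_id, map_add, map_sub, map_sum, map_smul, LinearMap.comp_zero, map_zero,
      Submodule.trace_orthProj, smul_eq_mul] using h1
  have hC : ∑ i, (d i : ℂ) * (Module.finrank ℂ (K i) : ℂ) =
      -∑ i, ∑ j, ∑ α : i ⟶ j, LinearMap.trace ℂ (H.obj j) ((H.map α).offDiag (K i) (K j) ∘ₗ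
        LinearMap.adjoint ((H.map α).offDiag (K i) (K j))) := by
    simp only [fun i j (α : i ⟶ j) => LinearMap.trace_offDiag (hK α), Finset.sum_sub_distrib]
    have h2 := Finset.sum_congr rfl fun i (_ : i ∈ Finset.univ) => h i
    simp only [Finset.sum_add_distrib, Finset.sum_sub_distrib, Finset.sum_const_zero] at h2
    rw [Finset.sum_comm] at h2
    linear_combination h2
  have := congrArg Complex.re hC
  simpa using this

theorem IsKing.degree_nonpos {d : V → ℝ} {H : HermRep.{u, v, w} V} (hH : H.IsKing d)
    {K : ∀ i, Submodule ℂ (H.obj i)}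
    (hK : ∀ {i j : V} (α : i ⟶ j), ∀ x ∈ K i, H.map α x ∈ K j) :
    ∑ i, d i * (Module.finrank ℂ (K i) : ℝ) ≤ 0 := by
  rw [hH.degree_sub hK, neg_nonpos]
  exact Finset.sum_nonneg fun _ _ => Finset.sum_nonneg fun _ _ => Finset.sum_nonneg fun _ _ =>
    LinearMap.trace_comp_adjoint_re_nonneg _

/-- The degree is minus a sum of squared norms, so if it is zero every off-diagonal part vanishes.
-/
theorem IsKing.map_orthogonal {d : V → ℝ} {H : HermRep.{u, v, w} V} (hH : H.IsKing d)
    {K : ∀ i, Submodule ℂ (H.obj i)}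
    (hK : ∀ {i j : V} (α : i ⟶ j), ∀ x ∈ K i, H.map α x ∈ K j)
    (hdeg : ∑ i, d i * (Module.finrank ℂ (K i) : ℝ) = 0) {i j : V} (α : i ⟶ j) :
    ∀ x ∈ (K i)ᗮ, H.map α x ∈ (K j)ᗮ := by
  refine LinearMap.map_orthogonal_of_offDiag_eq_zero
    (LinearMap.eq_zero_of_trace_comp_adjoint_re ?_)
  rw [hH.degree_sub hK, neg_eq_zero] at hdeg
  have h0 : ∀ i j (α : i ⟶ j), 0 ≤ (LinearMap.trace ℂ (H.obj j) ((H.map α).offDiag (K i) (K j) ∘ₗ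
      LinearMap.adjoint ((H.map α).offDiag (K i) (K j)))).re := fun i j α =>
    LinearMap.trace_comp_adjoint_re_nonneg _
  have h1 := (Finset.sum_eq_zero_iff_of_nonneg fun i _ => Finset.sum_nonneg fun j _ =>
    Finset.sum_nonneg fun α _ => h0 i j α).1 hdeg i (Finset.mem_univ _)
  have h2 := (Finset.sum_eq_zero_iff_of_nonneg fun j _ =>
    Finset.sum_nonneg fun α _ => h0 i j α).1 h1 j (Finset.mem_univ _)
  exact (Finset.sum_eq_zero_iff_of_nonneg fun α _ => h0 i j α).1 h2 α (Finset.mem_univ _)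

theorem IsKing.degree_eq_zero {d : V → ℝ} {H : HermRep.{u, v, w} V} (hH : H.IsKing d) :
    degree d H.toRep = 0 := by
  have h := hH.degree_sub (K := fun _ => ⊤) fun _ _ _ => trivial
  have h0 : ∀ i j (α : i ⟶ j), (H.map α).offDiag ⊤ ⊤ = 0 := by
    intro i j α
    refine LinearMap.ext fun x => ?_
    have : (⊤ : Submodule ℂ (H.obj i)).orthProj x = x := (Submodule.orthProj_isProj ⊤).2 x trivial
    simp [LinearMap.offDiag, this]
  have h1 : ∑ i, d i * (Module.finrank ℂ (H.obj i) : ℝ) = 0 := by simpa [h0] using h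
  exact h1

/-- The isomorphism between two ways of looking at a subrepresentation. -/
def subIso (H : HermRep.{u, v, w} V) (F : Subrep H.toRep) :
    Iso F.toRep (H.sub F.carrier F.map_mem).toRep where
  equiv i := LinearEquiv.refl ℂ (F.carrier i)
  comm _ _ := rfl

/-- A solution of the moment map equation is polystable. -/
theorem IsKing.isPolystableOfSlope {θ : V → ℝ} {μ : ℝ} {H : HermRep.{u, v, w} V}
    (hH : H.IsKing fun i => θ i - μ) : H.toRep.IsPolystableOfSlope θ μ := by
  obtain ⟨n, hn⟩ : ∃ n, H.toRep.totalDim = n := ⟨_, rfl⟩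
  induction n using Nat.strong_induction_on generalizing H with
  | _ n ih =>
    rcases Nat.eq_zero_or_pos H.toRep.totalDim with h0 | hpos
    · refine ⟨Empty, inferInstance, Empty.elim, fun k => k.elim, ⟨⟨fun i => ?_, fun α x => ?_⟩⟩⟩
      · have : Subsingleton (H.toRep.obj i) := by
          rw [← Module.finrank_zero_iff (R := ℂ)]
          exact (Finset.sum_eq_zero_iff.1 h0) i (Finset.mem_univ i)
        exact
          { toFun := fun _ k => k.elim
            map_add' := fun _ _ => funext fun k => k.elim
            map_smul' := fun _ _ => funext fun k => k.elim
            invFun := fun _ => 0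
            left_inv := fun _ => Subsingleton.elim _ _
            right_inv := fun _ => funext fun k => k.elim }
      · exact funext fun k => k.elim
    have hslope : slope θ H.toRep = μ := by
      have h1 := hH.degree_eq_zero
      rw [degree_sub_const _ _ _ hpos] at h1
      rcases mul_eq_zero.1 h1 with h2 | h2
      · linarith
      · rw [Nat.cast_eq_zero] at h2
        omega
    by_cases hst : ∀ F : Subrep H.toRep, (∃ i, F.carrier i ≠ ⊥) → (∃ i, F.carrier i ≠ ⊤) →
        slope θ F.toRep < slope θ H.toRep
    · exact ⟨Unit, inferInstance, fun _ => H.toRep,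
        fun _ => ⟨⟨(totalDim_pos_iff _).1 hpos, hst⟩, hslope⟩,
        ⟨⟨fun i => (LinearEquiv.funUnique Unit ℂ (H.toRep.obj i)).symm, fun _ _ => rfl⟩⟩⟩
    push Not at hst
    obtain ⟨F, hbot, htop, hle⟩ := hst
    rw [hslope] at hle
    have hFpos := F.totalDim_pos_iff.2 hbot
    -- King's equation bounds the degree above by zero, and the failure of stability bounds it below
    -- by zero.
    have hFdeg : ∑ i, (θ i - μ) * (Module.finrank ℂ (F.carrier i) : ℝ) = 0 := by
      refine le_antisymm (hH.degree_nonpos F.map_mem) ?_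
      have h1 := degree_sub_const θ μ _ hFpos
      refine le_of_le_of_eq ?_ h1.symm
      exact mul_nonneg (sub_nonneg.2 hle) (Nat.cast_nonneg _)
    let K : ∀ i, Submodule ℂ (H.obj i) := F.carrier
    have hF' : ∀ {i j : V} (α : i ⟶ j), ∀ x ∈ (K i)ᗮ,
        H.map α x ∈ (K j)ᗮ :=
      fun α => hH.map_orthogonal F.map_mem hFdeg α
    let K' : ∀ i, Submodule ℂ (H.obj i) := fun i => (K i)ᗮ
    let G : Subrep H.toRep := ⟨K', hF'⟩
    -- Since the complement is preserved by the edge maps, its own complement `K` is preserved by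
    -- their adjoints. Hence King's equation restricts to both summands with the same `μ`.
    have hGF : ∀ {i j : V} (α : i ⟶ j), ∀ y ∈ K j,
        LinearMap.adjoint (H.map α) y ∈ (K i) := by
      intro i j α y hy
      rw [← Submodule.orthogonal_orthogonal (K i)]
      refine LinearMap.adjoint_mem_orthogonal (hF' α) y ?_
      rwa [Submodule.orthogonal_orthogonal]
    have hKF : (H.sub F.carrier F.map_mem).IsKing fun i => θ i - μ := hH.sub F.map_mem hGF
    have hKG : (H.sub G.carrier G.map_mem).IsKing fun i => θ i - μ :=
      hH.sub G.map_mem fun α => LinearMap.adjoint_mem_orthogonal (F.map_mem α)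
    have hdim : F.toRep.totalDim + G.toRep.totalDim = H.toRep.totalDim := by
      rw [totalDim, totalDim, totalDim, ← Finset.sum_add_distrib]
      exact Finset.sum_congr rfl fun i _ =>
        Submodule.finrank_add_finrank_orthogonal (K i)
    have hGpos : 0 < G.toRep.totalDim := by
      rw [G.totalDim_pos_iff]
      obtain ⟨i, hi⟩ := htop
      refine ⟨i, fun h => hi ?_⟩
      exact (Submodule.orthogonal_eq_bot_iff (K := (K i))).1 h
    obtain ⟨ι, _, S, hS, ⟨e⟩⟩ := ih F.toRep.totalDim (by omega) hKF rfl
    obtain ⟨κ, _, T, hT, ⟨f⟩⟩ := ih G.toRep.totalDim (by omega) hKG rfl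
    refine ⟨ι ⊕ κ, inferInstance, Sum.elim S T, ?_,
      ⟨(Iso.ofIsCompl (fun i => ?_) ((subIso H F).trans e) ((subIso H G).trans f)).symm⟩⟩
    · rintro (k | k)
      exacts [hS k, hT k]
    · exact Submodule.isCompl_orthogonal
        (K := (K i))

/-- A polystable representation carries a metric that satisfies the moment map equation. -/
theorem exists_isKing_of_isPolystable {θ : V → ℝ} {E : QuiverRep.{u, v, w} V}
    (hE : E.IsPolystable θ) : ∃ (μ : ℝ) (H : HermRep.{u, v, w} V),
      H.IsKing (fun i => θ i - μ) ∧ Nonempty (Iso E H.toRep) := by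
  obtain ⟨n, S, hS, hslope, ⟨e⟩⟩ := hE
  obtain ⟨μ, hμ⟩ : ∃ μ, ∀ k, slope θ (S k) = μ := by
    rcases n with _ | n
    -- For the empty direct sum any slope will do.
    · exact ⟨0, fun k => k.elim0⟩
    · exact ⟨slope θ (S 0), fun k => hslope k 0⟩
  choose H hH f using fun k => exists_isKing_of_isStable (hS k)
  simp only [hμ] at hH
  exact ⟨μ, HermRep.directSum H, IsKing.directSum hH,
    ⟨(e.trans (Iso.directSum fun k => (f k).some)).trans (directSumIso H)⟩⟩

end HermRep

/-! ### Sums over the edges at a vertex of the tensor quiver -/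

section TensorQuiver

variable {V' : Type u₁} {V'' : Type u₂} [Quiver.{v₁} V'] [Quiver.{v₂} V'']

/-- The edges of the tensor quiver with given head. -/
def TensorQuiver.inEquiv (k : V') (l : V'') :
    (Σ i, (i ⟶ k)) ⊕ (Σ j, (j ⟶ l)) ≃
      Σ p : TensorQuiver V' V'', (p ⟶ (⟨k, l⟩ : TensorQuiver V' V'')) where
  toFun
    | Sum.inl e => ⟨⟨e.1, l⟩, Edge.left e.2 l⟩
    | Sum.inr e => ⟨⟨k, e.1⟩, Edge.right k e.2⟩
  invFun
    | ⟨_, Edge.left α _⟩ => Sum.inl ⟨_, α⟩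
    | ⟨_, Edge.right _ β⟩ => Sum.inr ⟨_, β⟩
  left_inv
    | Sum.inl _ => rfl
    | Sum.inr _ => rfl
  right_inv
    | ⟨_, Edge.left _ _⟩ => rfl
    | ⟨_, Edge.right _ _⟩ => rfl

/-- The edges of the tensor quiver with given tail. -/
def TensorQuiver.outEquiv (k : V') (l : V'') :
    (Σ i, (k ⟶ i)) ⊕ (Σ j, (l ⟶ j)) ≃
      Σ p : TensorQuiver V' V'', ((⟨k, l⟩ : TensorQuiver V' V'') ⟶ p) where
  toFun
    | Sum.inl e => ⟨⟨e.1, l⟩, Edge.left e.2 l⟩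
    | Sum.inr e => ⟨⟨k, e.1⟩, Edge.right k e.2⟩
  invFun
    | ⟨_, Edge.left α _⟩ => Sum.inl ⟨_, α⟩
    | ⟨_, Edge.right _ β⟩ => Sum.inr ⟨_, β⟩
  left_inv
    | Sum.inl _ => rfl
    | Sum.inr _ => rfl
  right_inv
    | ⟨_, Edge.left _ _⟩ => rfl
    | ⟨_, Edge.right _ _⟩ => rfl

theorem TensorQuiver.finite_hom [Finite V'] [Finite V''] [∀ i k : V', Finite (i ⟶ k)]
    [∀ j l : V'', Finite (j ⟶ l)] (p q : TensorQuiver V' V'') : Finite (p ⟶ q) := by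
  obtain ⟨k, l⟩ := q
  have : Finite (Σ p : TensorQuiver V' V'', (p ⟶ (⟨k, l⟩ : TensorQuiver V' V''))) :=
    Finite.of_equiv _ (TensorQuiver.inEquiv k l)
  exact Finite.of_injective (Sigma.mk p : _ →
    Σ p : TensorQuiver V' V'', (p ⟶ (⟨k, l⟩ : TensorQuiver V' V''))) sigma_mk_injective

variable [Fintype V'] [Fintype V'']
  [∀ i k : V', Fintype (i ⟶ k)] [∀ j l : V'', Fintype (j ⟶ l)]
  [∀ p q : TensorQuiver V' V'', Fintype (p ⟶ q)] {M : Type*} [AddCommMonoid M]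

theorem TensorQuiver.sum_in (k : V') (l : V'')
    (f : ∀ p : TensorQuiver V' V'', (p ⟶ (⟨k, l⟩ : TensorQuiver V' V'')) → M) :
    ∑ p, ∑ α, f p α = ∑ i, ∑ α : i ⟶ k, f ⟨i, l⟩ (Edge.left α l) +
      ∑ j, ∑ β : j ⟶ l, f ⟨k, j⟩ (Edge.right k β) := by
  rw [← Fintype.sum_sigma' f, ← (TensorQuiver.inEquiv k l).sum_comp, Fintype.sum_sum_type,
    Fintype.sum_sigma, Fintype.sum_sigma]
  rfl

theorem TensorQuiver.sum_out (k : V') (l : V'')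
    (f : ∀ p : TensorQuiver V' V'', ((⟨k, l⟩ : TensorQuiver V' V'') ⟶ p) → M) :
    ∑ p, ∑ α, f p α = ∑ i, ∑ α : k ⟶ i, f ⟨i, l⟩ (Edge.left α l) +
      ∑ j, ∑ β : l ⟶ j, f ⟨k, j⟩ (Edge.right k β) := by
  rw [← Fintype.sum_sigma' f, ← (TensorQuiver.outEquiv k l).sum_comp, Fintype.sum_sum_type,
    Fintype.sum_sigma, Fintype.sum_sigma]
  rfl

end TensorQuiver

/-! ### Tensor products of solutions -/

namespace HermRep

open QuiverRep

variable {V' : Type u₁} {V'' : Type u₂} [Quiver.{v₁} V'] [Quiver.{v₂} V'']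

/-- The tensor product of hermitian representations. -/
noncomputable def tensor (H : HermRep.{u₁, v₁, w₁} V') (K : HermRep.{u₂, v₂, w₂} V'') :
    HermRep.{max u₁ u₂, max u₁ u₂ v₁ v₂, max w₁ w₂} (TensorQuiver V' V'') where
  obj p := H.obj p.fst ⊗[ℂ] K.obj p.snd
  map
    | TensorQuiver.Edge.left α j => (H.map α).rTensor (K.obj j)
    | TensorQuiver.Edge.right i β => (K.map β).lTensor (H.obj i)

/-- The tensor product respects isomorphisms. -/
noncomputable def tensorIso {φ : QuiverRep.{u₁, v₁, w₁} V'} {ψ : QuiverRep.{u₂, v₂, w₂} V''}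
    {H : HermRep.{u₁, v₁, w₁} V'} {K : HermRep.{u₂, v₂, w₂} V''}
    (e : Iso φ H.toRep) (f : Iso ψ K.toRep) : Iso (φ.tensor ψ) (H.tensor K).toRep where
  equiv p := TensorProduct.congr (e.equiv p.fst) (f.equiv p.snd)
  comm := by
    rintro _ _ (⟨α, j⟩ | ⟨i, β⟩) x
    · exact LinearMap.congr_fun (TensorProduct.ext'
        (g := (TensorProduct.congr (e.equiv _) (f.equiv j)).toLinearMap ∘ₗ
          (φ.tensor ψ).map (TensorQuiver.Edge.left α j))
        (h := (H.tensor K).toRep.map (TensorQuiver.Edge.left α j) ∘ₗ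
          (TensorProduct.congr (e.equiv _) (f.equiv j)).toLinearMap)
        fun x y => congrArg (fun z => z ⊗ₜ[ℂ] f.equiv j y) (e.comm α x)) x
    · exact LinearMap.congr_fun (TensorProduct.ext'
        (g := (TensorProduct.congr (e.equiv i) (f.equiv _)).toLinearMap ∘ₗ
          (φ.tensor ψ).map (TensorQuiver.Edge.right i β))
        (h := (H.tensor K).toRep.map (TensorQuiver.Edge.right i β) ∘ₗ
          (TensorProduct.congr (e.equiv i) (f.equiv _)).toLinearMap)
        fun x y => congrArg (fun z => e.equiv i x ⊗ₜ[ℂ] z) (f.comm β y)) x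

variable [Fintype V'] [Fintype V''] [∀ i k : V', Fintype (i ⟶ k)] [∀ j l : V'', Fintype (j ⟶ l)]
  [∀ p q : TensorQuiver V' V'', Fintype (p ⟶ q)]

/-- King's equation is a sum over single edges, so no cross terms between the factors arise. For the
tensor product metric, adjoints commute with tensoring by an identity, so the two equations,
tensored with identities, add up. -/
theorem IsKing.tensor {d' : V' → ℝ} {d'' : V'' → ℝ} {H : HermRep.{u₁, v₁, w₁} V'}
    {K : HermRep.{u₂, v₂, w₂} V''} (hH : H.IsKing d') (hK : K.IsKing d'') :
    (H.tensor K).IsKing fun p => d' p.fst + d'' p.snd := by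
  rintro ⟨k, l⟩
  rw [TensorQuiver.sum_in, TensorQuiver.sum_out]
  have h1 := congrArg (LinearMap.rTensorHom (K.obj l)) (hH k)
  have h2 := congrArg (LinearMap.lTensorHom (H.obj k)) (hK l)
  simp only [map_add, map_sub, map_sum, map_smul, map_zero, LinearMap.coe_rTensorHom,
    LinearMap.coe_lTensorHom, LinearMap.rTensor_comp, LinearMap.lTensor_comp,
    LinearMap.rTensor_id, LinearMap.lTensor_id, ← LinearMap.adjoint_rTensor,
    ← LinearMap.adjoint_lTensor] at h1 h2
  have h3 := congrArg₂ (· + ·) h1 h2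
  rw [add_zero] at h3
  refine Eq.trans ?_ h3
  rw [Complex.ofReal_add, add_smul]
  dsimp only
  change _ + _ - (_ + _) + (_ + _) = _ - _ + _ + (_ - _ + _)
  rw [add_sub_add_comm, add_add_add_comm]
  rfl

end HermRep

theorem mainTheorem2 {V' : Type u₁} {V'' : Type u₂}
    [Quiver.{v₁} V'] [Quiver.{v₂} V''] [Fintype V'] [Fintype V'']
    [∀ i k : V', Finite (i ⟶ k)] [∀ j l : V'', Finite (j ⟶ l)]
    (θ' : V' → ℝ) (θ'' : V'' → ℝ)
    (φ : QuiverRep.{u₁, v₁, w₁} V') (ψ : QuiverRep.{u₂, v₂, w₂} V'')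
    (hφ : φ.IsPolystable θ') (hψ : ψ.IsPolystable θ'') :
    (φ.tensor ψ).IsPolystable (fun p : TensorQuiver V' V'' => θ' p.fst + θ'' p.snd) := by
  have := fun i k : V' => Fintype.ofFinite (i ⟶ k)
  have := fun j l : V'' => Fintype.ofFinite (j ⟶ l)
  have := fun p q : TensorQuiver V' V'' =>
    have := TensorQuiver.finite_hom p q
    Fintype.ofFinite (p ⟶ q)
  obtain ⟨μ', H, hH, ⟨e⟩⟩ := HermRep.exists_isKing_of_isPolystable hφ
  obtain ⟨μ'', K, hK, ⟨f⟩⟩ := HermRep.exists_isKing_of_isPolystable hψ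
  have h := hH.tensor hK
  -- The shifts combine to give the weights `θ' + θ''` minus the common slope `μ' + μ''`.
  simp only [sub_add_sub_comm] at h
  exact (h.isPolystableOfSlope.of_iso (HermRep.tensorIso e f)).isPolystable
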